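/- For a graph $G$ and an integer $k$, let $TAR_k(G)$ be the graph whose vertices are the independent sets of $G$ with at least $k$ elements, two of them being adjacent when one is obtained from the other by adding exactly one vertex. A cograph is a graph with no induced path on four vertices. There is an algorithm that, given a cograph $G$ on $n$ vertices (by its adjacency matrix) and an integer $k$, decides in time $O(n^3)$ whether $TAR_k(G)$ is connected. Here time is the number of elementary operations of a random access machine (one fixed program, with integer variables and arrays, addition, subtraction, multiplication, comparison, indirect reading and writing, each of unit cost) whose words have $O(\log(n+|k|+2))$ bits. The constants do not depend on $G$, $n$ or $k$, the bound is read as $O(1)$ for $n=0$, and, as usual, a connected graph is non-empty (so the answer is NO if $G$ has no independent set of size at least $k$). -/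

import Mathlib

/-! ## Cographs and the token addition and removal graph -/

/-- A cograph: a graph with no induced path on four vertices. -/
def IsCograph {V : Type*} (G : SimpleGraph V) : Prop :=
  ¬ Nonempty (SimpleGraph.pathGraph 4 ↪g G)

/-- The `k`-independent sets of `G`: the independent sets with at least `k` vertices. -/
def KIndepSet {V : Type*} (G : SimpleGraph V) (k : ℤ) : Type _ :=
  {S : Finset V // G.IsIndepSet (S : Set V) ∧ k ≤ (S.card : ℤ)}

/-- The graph `TAR_k(G)` on the `k`-independent sets of `G`: two of them are adjacent when one is
obtained from the other by adding exactly one vertex. -/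
def tarGraph {V : Type*} [DecidableEq V] (G : SimpleGraph V) (k : ℤ) :
    SimpleGraph (KIndepSet G k) where
  Adj I J := ∃ u, (u ∉ I.1 ∧ J.1 = insert u I.1) ∨ (u ∉ J.1 ∧ I.1 = insert u J.1)
  symm := ⟨fun _ _ ⟨u, h⟩ => ⟨u, h.symm⟩⟩
  loopless := ⟨fun I ⟨u, h⟩ => by
    rcases h with ⟨hu, h⟩ | ⟨hu, h⟩ <;> exact hu (h ▸ Finset.mem_insert_self u _)⟩

/-! ## A random access machine with step count

Programs are structured programs over integer variables and integer arrays with random access.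
A program is a fixed finite object, so it uses finitely many variables and arrays, and its
expressions have bounded size. Every elementary operation costs one unit of time. -/

namespace Ram

/-- The memory: integer variables `x₀, x₁, …` and integer arrays `A₀, A₁, …`. -/
structure State where
  var : ℕ → ℤ
  arr : ℕ → ℤ → ℤ

/-- Integer expressions; `read a e` is the cell `A_a[e]`. -/
inductive Expr where
  | const (z : ℤ)
  | var (x : ℕ)
  | read (a : ℕ) (e : Expr)
  | add (e₁ e₂ : Expr)
  | sub (e₁ e₂ : Expr)
  | mul (e₁ e₂ : Expr)

/-- The value of an expression. -/
def Expr.eval (σ : State) : Expr → ℤ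
  | .const z => z
  | .var x => σ.var x
  | .read a e => σ.arr a (e.eval σ)
  | .add e₁ e₂ => e₁.eval σ + e₂.eval σ
  | .sub e₁ e₂ => e₁.eval σ - e₂.eval σ
  | .mul e₁ e₂ => e₁.eval σ * e₂.eval σ

/-- The number of elementary operations used to evaluate an expression. -/
def Expr.cost : Expr → ℕ
  | .const _ => 1
  | .var _ => 1
  | .read _ e => e.cost + 1
  | .add e₁ e₂ => e₁.cost + e₂.cost + 1
  | .sub e₁ e₂ => e₁.cost + e₂.cost + 1
  | .mul e₁ e₂ => e₁.cost + e₂.cost + 1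

/-- Tests. -/
inductive Test where
  | eq (e₁ e₂ : Expr)
  | lt (e₁ e₂ : Expr)
  | not (b : Test)
  | and (b₁ b₂ : Test)

/-- The truth value of a test. -/
def Test.Holds (σ : State) : Test → Prop
  | .eq e₁ e₂ => e₁.eval σ = e₂.eval σ
  | .lt e₁ e₂ => e₁.eval σ < e₂.eval σ
  | .not b => ¬ b.Holds σ
  | .and b₁ b₂ => b₁.Holds σ ∧ b₂.Holds σ

/-- The number of elementary operations used to evaluate a test. -/
def Test.cost : Test → ℕ
  | .eq e₁ e₂ => e₁.cost + e₂.cost + 1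
  | .lt e₁ e₂ => e₁.cost + e₂.cost + 1
  | .not b => b.cost + 1
  | .and b₁ b₂ => b₁.cost + b₂.cost + 1

/-- Programs. -/
inductive Program where
  | skip
  | assign (x : ℕ) (e : Expr)
  | store (a : ℕ) (i e : Expr)
  | seq (p q : Program)
  | ite (b : Test) (p q : Program)
  | while (b : Test) (p : Program)

/-- The memory after writing `v` into the variable `x`. -/
def State.setVar (σ : State) (x : ℕ) (v : ℤ) : State :=
  { σ with var := Function.update σ.var x v }

/-- The memory after writing `v` into the cell `A_a[i]`. -/
def State.setArr (σ : State) (a : ℕ) (i v : ℤ) : State :=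
  { σ with arr := Function.update σ.arr a (Function.update (σ.arr a) i v) }

/-- `Exec W p σ t τ`: the program `p`, started in the memory `σ`, halts after exactly `t`
elementary operations in the memory `τ`, and every number that it writes, and every array index
to which it writes, has absolute value at most the word size bound `W` (a run that would write a
larger number is stuck). -/
inductive Exec (W : ℤ) : Program → State → ℕ → State → Prop where
  | skip (σ : State) : Exec W .skip σ 1 σ
  | assign (σ : State) (x : ℕ) (e : Expr) (hv : |e.eval σ| ≤ W) :
      Exec W (.assign x e) σ (e.cost + 1) (σ.setVar x (e.eval σ))
  | store (σ : State) (a : ℕ) (i e : Expr) (hi : |i.eval σ| ≤ W) (hv : |e.eval σ| ≤ W) :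
      Exec W (.store a i e) σ (i.cost + e.cost + 1) (σ.setArr a (i.eval σ) (e.eval σ))
  | seq {p q : Program} {σ τ υ : State} {s t : ℕ}
      (hp : Exec W p σ s τ) (hq : Exec W q τ t υ) : Exec W (.seq p q) σ (s + t) υ
  | ite_true {b : Test} {p q : Program} {σ τ : State} {t : ℕ}
      (hb : b.Holds σ) (hp : Exec W p σ t τ) : Exec W (.ite b p q) σ (b.cost + 1 + t) τ
  | ite_false {b : Test} {p q : Program} {σ τ : State} {t : ℕ}
      (hb : ¬ b.Holds σ) (hq : Exec W q σ t τ) : Exec W (.ite b p q) σ (b.cost + 1 + t) τ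
  | while_false {b : Test} {p : Program} {σ : State}
      (hb : ¬ b.Holds σ) : Exec W (.while b p) σ (b.cost + 1) σ
  | while_true {b : Test} {p : Program} {σ τ υ : State} {s t : ℕ}
      (hb : b.Holds σ) (hp : Exec W p σ s τ) (hw : Exec W (.while b p) τ t υ) :
      Exec W (.while b p) σ (b.cost + 1 + s + t) υ

open Classical in
/-- The input memory for a graph `G` on `n` vertices and an integer `k`: `x₀ = n`, `x₁ = k`, the
array `A₀` holds the adjacency matrix of `G` row by row, and everything else is `0`. -/
noncomputable def inputState {n : ℕ} (G : SimpleGraph (Fin n)) (k : ℤ) : State where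
  var x := if x = 0 then (n : ℤ) else if x = 1 then k else 0
  arr a z :=
    if a = 0 ∧ ∃ i j : Fin n, z = (i : ℤ) * (n : ℤ) + (j : ℤ) ∧ G.Adj i j then 1 else 0

end Ram

/-! For k ≤ 0 every independent set shrinks to ∅, so the answer is always yes. For k > 0 the
algorithm computes, for growing modules M of G, three data (`Summary`): the independence number a of
G[M]; the spread e, the least loss that lets any two maximum independent sets reach each other; and
the gaps g i, the least loss that lets every independent set of size i reach a larger one. On the
whole graph these decide connectedness (`Summary.tarGraph_connected_iff`): every set of size k ≤ i <
a must be able to climb without falling below k, and the maximum sets must be joined above k.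

The data can be composed. In a disjoint union the two sides move independently as long as neither
can grow, so a set escapes exactly when one of its traces does (`escapes_union_iff`,
`Summary.union`). In a join every independent set lies on one side, and the only passage between the
sides is ∅ (`Reach.of_join`, `Summary.join`).

A cograph on at least two vertices contains twins (`IsCograph.exists_twins`), because each of its
vertex sets of size at least two is disconnected or co-disconnected. Representatives of modules that
are twins can be merged into one module, a disjoint union if they are non-adjacent and a join
otherwise, and n - 1 merges leave a single module. With a table that counts, for each pair, the
remaining vertices distinguishing it, twins are found in O(n²) time, and merging the profiles and
updating the table also cost O(n²) (`runs_mergeTwins`). This gives O(n³) in total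
(`runs_decideConnected`). All numbers written are at most (n + 2)² in absolute value. -/

/-! ## Reconfiguration inside a vertex set -/

namespace IndepReconf

open Relation

section

variable {V : Type*} {G : SimpleGraph V} {A B M I J X Y : Finset V} {l m d : ℕ}

/-- `I` is an independent set of `G` inside `M`. -/
def IndepIn (G : SimpleGraph V) (M I : Finset V) : Prop :=
  I ⊆ M ∧ G.IsIndepSet (I : Set V)

theorem IndepIn.subset (h : IndepIn G M I) (hJ : J ⊆ I) : IndepIn G M J :=
  ⟨hJ.trans h.1, h.2.mono (Finset.coe_subset.2 hJ)⟩

theorem IndepIn.mono (h : IndepIn G A I) (hA : A ⊆ M) : IndepIn G M I :=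
  ⟨h.1.trans hA, h.2⟩

theorem indepIn_empty : IndepIn G M ∅ :=
  ⟨Finset.empty_subset _, by simp [SimpleGraph.IsIndepSet]⟩

variable [DecidableEq V]

/-- One of two sets is obtained from the other by adding one vertex. -/
def Differ (I J : Finset V) : Prop :=
  ∃ u, (u ∉ I ∧ J = insert u I) ∨ (u ∉ J ∧ I = insert u J)

/-- A reconfiguration step to an independent set inside `M` with at least `l` vertices. -/
def Step (G : SimpleGraph V) (M : Finset V) (l : ℕ) (I J : Finset V) : Prop :=
  IndepIn G M J ∧ l ≤ J.card ∧ Differ I J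

/-- Reconfiguration through independent sets inside `M` with at least `l` vertices. -/
def Reach (G : SimpleGraph V) (M : Finset V) (l : ℕ) : Finset V → Finset V → Prop :=
  ReflTransGen (Step G M l)

/-- `I` reaches a larger set without losing more than `d` vertices on the way. -/
def Escapes (G : SimpleGraph V) (M : Finset V) (d : ℕ) (I : Finset V) : Prop :=
  ∃ J, Reach G M (I.card - d) I J ∧ I.card < J.card

/-- `a` is the independence number of `G[M]`, `e` the loss needed to connect all maximum
independent sets, and `g i` the loss (truncated at `N + 1`) needed by every independent set of
size `i` to reach a larger one. -/
structure Summary (G : SimpleGraph V) (N : ℕ) (M : Finset V) (a e : ℕ) (g : ℕ → ℕ) : Prop where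
  exists_max : ∃ I, IndepIn G M I ∧ I.card = a
  card_le : ∀ I, IndepIn G M I → I.card ≤ a
  gap_le : ∀ i, g i ≤ N + 1
  gap_iff : ∀ i d, d ≤ N → (g i ≤ d ↔ ∀ I, IndepIn G M I → I.card = i → Escapes G M d I)
  spread_iff : ∀ d, e ≤ d ↔
    ∀ I J, IndepIn G M I → IndepIn G M J → I.card = a → J.card = a → Reach G M (a - d) I J

theorem Differ.symm (h : Differ I J) : Differ J I := by
  obtain ⟨u, h⟩ := h
  exact ⟨u, h.symm⟩

theorem IndepIn.inter (h : IndepIn G M I) : IndepIn G A (I ∩ A) :=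
  ⟨Finset.inter_subset_right, (h.subset Finset.inter_subset_left).2⟩

theorem Reach.mono (h : Reach G A l I J) (hA : A ⊆ M) (hm : m ≤ l) : Reach G M m I J :=
  ReflTransGen.mono (fun _ _ hs => ⟨hs.1.mono hA, hm.trans hs.2.1, hs.2.2⟩) _ _ h

theorem Reach.indepIn (h : Reach G M l I J) (hI : IndepIn G M I) : IndepIn G M J := by
  rcases ReflTransGen.cases_tail h with rfl | ⟨_, _, hs⟩
  · exact hI
  · exact hs.1

theorem Reach.le_card (h : Reach G M l I J) (hI : l ≤ I.card) : l ≤ J.card := by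
  rcases ReflTransGen.cases_tail h with rfl | ⟨_, _, hs⟩
  · exact hI
  · exact hs.2.1

/-- A step constrains only its target, so reversing a walk also needs an admissible start. -/
theorem Reach.symm (h : Reach G M l I J) (hI : IndepIn G M I) (hl : l ≤ I.card) :
    Reach G M l J I := by
  induction h with
  | refl => exact .refl
  | tail h hs ih =>
    exact ReflTransGen.head ⟨Reach.indepIn h hI, Reach.le_card h hl, hs.2.2.symm⟩ ih

theorem reach_empty (h : IndepIn G M I) : Reach G M 0 ∅ I := by
  induction I using Finset.induction_on with
  | empty => exact .refl
  | insert u I hu ih =>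
    exact (ih (h.subset (Finset.subset_insert _ _))).tail
      ⟨h, Nat.zero_le _, u, Or.inl ⟨hu, rfl⟩⟩

/-- With threshold 0 any two independent sets are linked through ∅. This settles every case below in
which the truncated difference of size and loss vanishes. -/
theorem reach_zero (hI : IndepIn G M I) (hJ : IndepIn G M J) : Reach G M 0 I J :=
  ((reach_empty hI).symm indepIn_empty (Nat.zero_le _)).trans (reach_empty hJ)

/-- A change outside `A` leaves the trace on `A` fixed; hence the conclusion is a walk, not a step.
-/
theorem Step.inter (h : Step G M l X Y) (hm : m ≤ (Y ∩ A).card) :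
    Reach G A m (X ∩ A) (Y ∩ A) := by
  obtain ⟨hY, -, u, h⟩ := h
  by_cases hu : u ∈ A
  · refine .single ⟨hY.inter, hm, u, ?_⟩
    rcases h with ⟨h, rfl⟩ | ⟨h, rfl⟩
    · exact Or.inl ⟨by simp [h], by rw [Finset.insert_inter_of_mem hu]⟩
    · exact Or.inr ⟨by simp [h], by rw [Finset.insert_inter_of_mem hu]⟩
  · rcases h with ⟨h, rfl⟩ | ⟨h, rfl⟩ <;> rw [Finset.insert_inter_of_notMem hu] <;> exact .refl

theorem Summary.spread_le {N a e : ℕ} {g : ℕ → ℕ} (h : Summary G N M a e g) : e ≤ a :=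
  (h.spread_iff a).2 fun I J hI hJ _ _ => by
    rw [Nat.sub_self]
    exact reach_zero hI hJ

theorem Summary.pos {N a e : ℕ} {g : ℕ → ℕ} (h : Summary G N M a e g) (hM : M.Nonempty) :
    0 < a := by
  obtain ⟨v, hv⟩ := hM
  have := h.card_le {v} ⟨by simpa using hv, by simp [SimpleGraph.IsIndepSet]⟩
  simpa [Nat.one_le_iff_ne_zero, Nat.pos_iff_ne_zero] using this

/-- The value `N + 1` plays the role of infinity: `{v}` has no larger set to reach. The empty set
grows without loss, and for sizes above 1 the condition is vacuous, which gives 0. -/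
theorem summary_singleton {N : ℕ} (v : V) :
    Summary G N {v} 1 0 (fun i => if i = 1 then N + 1 else 0) where
  exists_max := ⟨{v}, ⟨subset_rfl, by simp [SimpleGraph.IsIndepSet]⟩, by simp⟩
  card_le I hI := by simpa using Finset.card_le_card hI.1
  gap_le i := by split_ifs <;> omega
  gap_iff i d hd := by
    have hv : IndepIn G {v} {v} := ⟨subset_rfl, by simp [SimpleGraph.IsIndepSet]⟩
    constructor
    · rintro h I hI rfl
      have h1 : I.card ≤ 1 := by simpa using Finset.card_le_card hI.1
      have h2 : I.card ≠ 1 := by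
        intro h2
        simp only [h2, if_true] at h
        omega
      have h0 : I = ∅ := Finset.card_eq_zero.1 (by omega)
      subst h0
      exact ⟨{v}, by simpa using reach_zero indepIn_empty hv, by simp⟩
    · intro h
      split_ifs with h1
      · obtain ⟨J, hJ, hlt⟩ := h {v} hv (by simp [h1])
        have := Finset.card_le_card (hJ.indepIn hv).1
        omega
      · exact Nat.zero_le _
  spread_iff d := by
    refine ⟨fun _ I J hI hJ h1 h2 => ?_, fun _ => Nat.zero_le _⟩
    rw [Finset.eq_of_subset_of_card_le hI.1 (by simp [h1]),
      Finset.eq_of_subset_of_card_le hJ.1 (by simp [h2])]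
    exact .refl

end

/-! ### Disjoint unions -/

section

variable {V : Type*} [DecidableEq V] {G : SimpleGraph V} {A B I J I' J' X Y : Finset V}
  {l m L p q d : ℕ}

theorem IndepIn.union (hI : IndepIn G A I) (hJ : IndepIn G B J)
    (hn : ∀ x ∈ A, ∀ y ∈ B, ¬ G.Adj x y) : IndepIn G (A ∪ B) (I ∪ J) := by
  refine ⟨Finset.union_subset_union hI.1 hJ.1, ?_⟩
  intro x hx y hy hxy
  rcases Finset.mem_union.1 hx with hx | hx <;> rcases Finset.mem_union.1 hy with hy | hy
  · exact hI.2 hx hy hxy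
  · exact hn x (hI.1 hx) y (hJ.1 hy)
  · exact fun h => hn y (hI.1 hy) x (hJ.1 hx) h.symm
  · exact hJ.2 hx hy hxy

theorem Reach.union_right (h : Reach G A l I I') (hJ : IndepIn G B J) (hAB : Disjoint A B)
    (hn : ∀ x ∈ A, ∀ y ∈ B, ¬ G.Adj x y) (hI : IndepIn G A I) (hL : L ≤ l + J.card) :
    Reach G (A ∪ B) L (I ∪ J) (I' ∪ J) := by
  induction h with
  | refl => exact .refl
  | @tail X Y h hs ih =>
    have hX : IndepIn G A X := Reach.indepIn h hI
    refine ih.tail ⟨hs.1.union hJ hn, ?_, ?_⟩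
    · rw [Finset.card_union_of_disjoint (hAB.mono hs.1.1 hJ.1)]
      have := hs.2.1
      omega
    · obtain ⟨u, h | h⟩ := hs.2.2
      · have hu : u ∉ J := fun hu =>
          Finset.disjoint_left.1 hAB (hs.1.1 (h.2 ▸ Finset.mem_insert_self u X)) (hJ.1 hu)
        exact ⟨u, Or.inl ⟨by simp [h.1, hu], by rw [h.2, Finset.insert_union]⟩⟩
      · have hu : u ∉ J := fun hu =>
          Finset.disjoint_left.1 hAB (hX.1 (h.2 ▸ Finset.mem_insert_self u Y)) (hJ.1 hu)
        exact ⟨u, Or.inr ⟨by simp [h.1, hu], by rw [h.2, Finset.insert_union]⟩⟩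

theorem card_inter_add_card_inter (hAB : Disjoint A B) (hX : X ⊆ A ∪ B) :
    (X ∩ A).card + (X ∩ B).card = X.card := by
  rw [← Finset.card_union_of_disjoint
    (hAB.mono Finset.inter_subset_right Finset.inter_subset_right),
    ← Finset.inter_union_distrib_left, Finset.inter_eq_left.2 hX]

theorem inter_union_inter (hX : X ⊆ A ∪ B) : X ∩ A ∪ X ∩ B = X := by
  rw [← Finset.inter_union_distrib_left, Finset.inter_eq_left.2 hX]

/-- As long as neither side can grow beyond `p`, `q`, the two sides move independently. -/
theorem Reach.inter_of_bounded (h : Reach G (A ∪ B) L X Y) (hAB : Disjoint A B)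
    (hX : IndepIn G (A ∪ B) X)
    (hp : ∀ I, Reach G A l (X ∩ A) I → I.card ≤ p) (hq : ∀ J, Reach G B m (X ∩ B) J → J.card ≤ q)
    (hl : l + q ≤ L ∨ l = 0) (hm : m + p ≤ L ∨ m = 0) :
    Reach G A l (X ∩ A) (Y ∩ A) ∧ Reach G B m (X ∩ B) (Y ∩ B) := by
  induction h with
  | refl => exact ⟨.refl, .refl⟩
  | @tail Y Z h hs ih =>
    have hc := card_inter_add_card_inter hAB hs.1.1
    have hY := card_inter_add_card_inter hAB (Reach.indepIn h hX).1
    have hLZ := hs.2.1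
    have h1 := hp _ ih.1
    have h2 := hq _ ih.2
    obtain ⟨u, hu⟩ := hs.2.2
    -- A step changes only one side. The unchanged side has at most `p` or `q` vertices, so the
    -- bound `L` on the total leaves at least `m` or `l` on the other. The alternatives `l = 0` and
    -- `m = 0` absorb truncated subtraction.
    have key : Z ∩ A = Y ∩ A ∨ Z ∩ B = Y ∩ B := by
      by_cases huA : u ∈ A
      · right
        have huB : u ∉ B := Finset.disjoint_left.1 hAB huA
        rcases hu with ⟨-, hu⟩ | ⟨-, hu⟩ <;> rw [hu, Finset.insert_inter_of_notMem huB]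
      · left
        rcases hu with ⟨-, hu⟩ | ⟨-, hu⟩ <;> rw [hu, Finset.insert_inter_of_notMem huA]
    rcases key with e | e
    · rw [e] at hc ⊢
      exact ⟨ih.1, ih.2.trans (hs.inter (by omega))⟩
    · rw [e] at hc ⊢
      exact ⟨ih.1.trans (hs.inter (by omega)), ih.2⟩

/-- If neither trace escapes, the reachable traces never exceed their initial sizes, so the walk
projects to both sides and its end is no larger than its start. Conversely, one side moves while the
other is kept fixed. -/
theorem escapes_union_iff (hAB : Disjoint A B) (hn : ∀ x ∈ A, ∀ y ∈ B, ¬ G.Adj x y)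
    (hI : IndepIn G A I) (hJ : IndepIn G B J) :
    Escapes G (A ∪ B) d (I ∪ J) ↔ Escapes G A d I ∨ Escapes G B d J := by
  have hIJ : Disjoint I J := hAB.mono hI.1 hJ.1
  have hcard : (I ∪ J).card = I.card + J.card := Finset.card_union_of_disjoint hIJ
  have eA : (I ∪ J) ∩ A = I := by
    rw [Finset.union_inter_distrib_right, Finset.inter_eq_left.2 hI.1,
      Finset.disjoint_iff_inter_eq_empty.1 (hAB.symm.mono_left hJ.1), Finset.union_empty]
  have eB : (I ∪ J) ∩ B = J := by
    rw [Finset.union_inter_distrib_right, Finset.inter_eq_left.2 hJ.1,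
      Finset.disjoint_iff_inter_eq_empty.1 (hAB.mono_left hI.1), Finset.empty_union]
  constructor
  · rintro ⟨Y, hY, hlt⟩
    by_contra! hne
    have hp : ∀ K, Reach G A (I.card - d) I K → K.card ≤ I.card := fun K hK => by
      by_contra! hK'
      exact hne.1 ⟨K, hK, hK'⟩
    have hq : ∀ K, Reach G B (J.card - d) J K → K.card ≤ J.card := fun K hK => by
      by_contra! hK'
      exact hne.2 ⟨K, hK, hK'⟩
    have hU := hI.union hJ hn
    have := Reach.inter_of_bounded (l := I.card - d) (m := J.card - d) (p := I.card) (q := J.card)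
      hY hAB hU (by rwa [eA]) (by rwa [eB]) (by omega) (by omega)
    rw [eA, eB] at this
    have h1 := hp _ this.1
    have h2 := hq _ this.2
    have := card_inter_add_card_inter hAB (hY.indepIn hU).1
    omega
  · rintro (⟨K, hK, hlt⟩ | ⟨K, hK, hlt⟩)
    · refine ⟨K ∪ J, hK.union_right hJ hAB hn hI (by omega), ?_⟩
      rw [Finset.card_union_of_disjoint (hAB.mono (hK.indepIn hI).1 hJ.1)]
      omega
    · refine ⟨I ∪ K, ?_, ?_⟩
      · rw [Finset.union_comm A B, Finset.union_comm I J, Finset.union_comm I K]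
        refine hK.union_right hI hAB.symm (fun x hx y hy h => hn y hy x hx h.symm) hJ ?_
        rw [Finset.union_comm J I]
        omega
      · rw [Finset.card_union_of_disjoint (hAB.mono hI.1 (hK.indepIn hJ).1)]
        omega

/-- A union of bad sets of sizes i and j is bad, so all splittings of s matter, and in each one good
side suffices. For the spread, the sides are moved one after the other. -/
theorem Summary.union {N a b e f : ℕ} {g h k : ℕ → ℕ} (hA : Summary G N A a e g)
    (hB : Summary G N B b f h) (hAB : Disjoint A B) (hn : ∀ x ∈ A, ∀ y ∈ B, ¬ G.Adj x y)
    (hk : ∀ s, k s ≤ N + 1)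
    (hkd : ∀ s d, d ≤ N → (k s ≤ d ↔ ∀ i j, i + j = s → g i ≤ d ∨ h j ≤ d)) :
    Summary G N (A ∪ B) (a + b) (max e f) k where
  exists_max := by
    obtain ⟨I, hI, rfl⟩ := hA.exists_max
    obtain ⟨J, hJ, rfl⟩ := hB.exists_max
    exact ⟨I ∪ J, hI.union hJ hn, Finset.card_union_of_disjoint (hAB.mono hI.1 hJ.1)⟩
  card_le I hI := by
    have h1 := hA.card_le _ (hI.inter (A := A))
    have h2 := hB.card_le _ (hI.inter (A := B))
    have := card_inter_add_card_inter hAB hI.1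
    omega
  gap_le := hk
  gap_iff s d hd := by
    rw [hkd s d hd]
    constructor
    · intro H X hX hs
      rw [← inter_union_inter hX.1, escapes_union_iff hAB hn hX.inter hX.inter]
      rcases H _ _ ((card_inter_add_card_inter hAB hX.1).trans hs) with H | H
      · exact Or.inl ((hA.gap_iff _ d hd).1 H _ hX.inter rfl)
      · exact Or.inr ((hB.gap_iff _ d hd).1 H _ hX.inter rfl)
    · intro H i j hij
      rw [hA.gap_iff i d hd, hB.gap_iff j d hd]
      by_contra! hne
      obtain ⟨⟨I, hI, hIc, hIe⟩, ⟨J, hJ, hJc, hJe⟩⟩ := hne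
      have := H (I ∪ J) (hI.union hJ hn)
        (by rw [Finset.card_union_of_disjoint (hAB.mono hI.1 hJ.1)]; omega)
      rw [escapes_union_iff hAB hn hI hJ] at this
      tauto
  spread_iff d := by
    rw [max_le_iff, hA.spread_iff, hB.spread_iff]
    constructor
    · rintro ⟨HA, HB⟩ X Y hX hY hXc hYc
      have hn' : ∀ x ∈ B, ∀ y ∈ A, ¬ G.Adj x y := fun x hx y hy h => hn y hy x hx h.symm
      have c1 := card_inter_add_card_inter hAB hX.1
      have c2 := card_inter_add_card_inter hAB hY.1
      have c3 := hA.card_le _ (hX.inter (A := A))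
      have c4 := hB.card_le _ (hX.inter (A := B))
      have c5 := hA.card_le _ (hY.inter (A := A))
      have c6 := hB.card_le _ (hY.inter (A := B))
      have r1 := (HA _ _ hX.inter hY.inter (by omega) (by omega)).union_right
        (hX.inter (A := B)) hAB hn hX.inter (L := a + b - d) (by omega)
      have r2 := (HB _ _ hX.inter hY.inter (by omega) (by omega)).union_right
        (hY.inter (A := A)) hAB.symm hn' hX.inter (L := a + b - d) (by omega)
      rw [inter_union_inter hX.1] at r1
      rw [Finset.union_comm B A, Finset.union_comm (X ∩ B), Finset.union_comm (Y ∩ B),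
        inter_union_inter hY.1] at r2
      exact r1.trans r2
    · intro H
      obtain ⟨I₀, hI₀, hI₀c⟩ := hA.exists_max
      obtain ⟨J₀, hJ₀, hJ₀c⟩ := hB.exists_max
      -- Maximum sets cannot grow, so a walk between unions of maximum sets projects to each side,
      -- and the loss on either side is at most `d`.
      have key : ∀ I J I' J', IndepIn G A I → IndepIn G B J → IndepIn G A I' → IndepIn G B J' →
          I.card = a → J.card = b → I'.card = a → J'.card = b →
          Reach G A (a - d) I I' ∧ Reach G B (b - d) J J' := by
        intro I J I' J' hI hJ hI' hJ' c1 c2 c3 c4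
        have hXe : ∀ {I J}, IndepIn G A I → IndepIn G B J →
            (I ∪ J) ∩ A = I ∧ (I ∪ J) ∩ B = J := by
          intro I J hI hJ
          constructor
          · rw [Finset.union_inter_distrib_right, Finset.inter_eq_left.2 hI.1,
              Finset.disjoint_iff_inter_eq_empty.1 (hAB.symm.mono_left hJ.1), Finset.union_empty]
          · rw [Finset.union_inter_distrib_right, Finset.inter_eq_left.2 hJ.1,
              Finset.disjoint_iff_inter_eq_empty.1 (hAB.mono_left hI.1), Finset.empty_union]
        have r := H (I ∪ J) (I' ∪ J') (hI.union hJ hn) (hI'.union hJ' hn)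
          (by rw [Finset.card_union_of_disjoint (hAB.mono hI.1 hJ.1), c1, c2])
          (by rw [Finset.card_union_of_disjoint (hAB.mono hI'.1 hJ'.1), c3, c4])
        have := Reach.inter_of_bounded (l := a - d) (m := b - d) (p := a) (q := b) r hAB
          (hI.union hJ hn) (fun K hK => hA.card_le K (hK.indepIn (by rw [(hXe hI hJ).1]; exact hI)))
          (fun K hK => hB.card_le K (hK.indepIn (by rw [(hXe hI hJ).2]; exact hJ)))
          (by omega) (by omega)
        rwa [(hXe hI hJ).1, (hXe hI hJ).2, (hXe hI' hJ').1, (hXe hI' hJ').2] at this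
      exact ⟨fun I I' hI hI' c c' => (key I J₀ I' J₀ hI hJ₀ hI' hJ₀ c hJ₀c c' hJ₀c).1,
        fun J J' hJ hJ' c c' => (key I₀ J I₀ J' hI₀ hJ hI₀ hJ' hI₀c c hI₀c c').2⟩

end

/-! ### Joins -/

section

variable {V : Type*} [DecidableEq V] {G : SimpleGraph V} {A B M I J X Y : Finset V}
  {l m d : ℕ}

theorem IndepIn.subset_or_subset (hI : IndepIn G (A ∪ B) I) (hj : ∀ x ∈ A, ∀ y ∈ B, G.Adj x y) :
    I ⊆ A ∨ I ⊆ B := by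
  by_contra! h
  obtain ⟨x, hx, hxA⟩ := Finset.not_subset.1 h.1
  obtain ⟨y, hy, hyB⟩ := Finset.not_subset.1 h.2
  have hx' := (Finset.mem_union.1 (hI.1 hx)).resolve_left hxA
  have hy' := (Finset.mem_union.1 (hI.1 hy)).resolve_right hyB
  have hadj := hj y hy' x hx'
  exact hI.2 hy hx hadj.ne hadj

/-- One of two consecutive sets contains the other, so nonempty ones cannot lie on different sides;
a positive threshold excludes ∅. -/
theorem Reach.of_join (h : Reach G (A ∪ B) l I J) (hl : 0 < l) (hI : IndepIn G A I)
    (hlI : l ≤ I.card) (hAB : Disjoint A B) (hj : ∀ x ∈ A, ∀ y ∈ B, G.Adj x y) :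
    Reach G A l I J := by
  induction h with
  | refl => exact .refl
  | @tail X Y h hs ih =>
    have hX : X ⊆ A := (ih.indepIn hI).1
    have hXc : 0 < X.card := hl.trans_le (ih.le_card hlI)
    have hYc : 0 < Y.card := hl.trans_le hs.2.1
    have hY : Y ⊆ A := by
      rcases hs.1.subset_or_subset hj with h | h
      · exact h
      · exfalso
        obtain ⟨u, hu | hu⟩ := hs.2.2
        · obtain ⟨x, hx⟩ := Finset.card_pos.1 hXc
          exact Finset.disjoint_left.1 hAB (hX hx) (h (hu.2 ▸ Finset.mem_insert_of_mem hx))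
        · obtain ⟨x, hx⟩ := Finset.card_pos.1 hYc
          exact Finset.disjoint_left.1 hAB (hX (hu.2 ▸ Finset.mem_insert_of_mem hx)) (h hx)
    exact ih.tail ⟨⟨hY, hs.1.2⟩, hs.2⟩

/-- The only escape that leaves `A` drops all of `I` and then builds a larger set in `B`, which
needs loss at least `I.card` and `I.card < b`. -/
theorem escapes_join_iff {N b f : ℕ} {h : ℕ → ℕ} (hB : Summary G N B b f h) (hAB : Disjoint A B)
    (hj : ∀ x ∈ A, ∀ y ∈ B, G.Adj x y) (hI : IndepIn G A I) :
    Escapes G (A ∪ B) d I ↔ Escapes G A d I ∨ I.card ≤ d ∧ I.card < b := by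
  constructor
  · rintro ⟨Y, hY, hlt⟩
    rcases le_or_gt I.card d with hd | hd
    · have hYM := hY.indepIn (hI.mono Finset.subset_union_left)
      rcases hYM.subset_or_subset hj with h | h
      · refine Or.inl ⟨Y, ?_, hlt⟩
        rw [Nat.sub_eq_zero_of_le hd]
        exact reach_zero hI ⟨h, hYM.2⟩
      · exact Or.inr ⟨hd, hlt.trans_le (hB.card_le Y ⟨h, hYM.2⟩)⟩
    · exact Or.inl ⟨Y, hY.of_join (by omega) hI (by omega) hAB hj, hlt⟩
  · rintro (⟨Y, hY, hlt⟩ | ⟨hd, hlt⟩)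
    · exact ⟨Y, hY.mono Finset.subset_union_left le_rfl, hlt⟩
    · obtain ⟨J, hJ, rfl⟩ := hB.exists_max
      refine ⟨J, ?_, hlt⟩
      rw [Nat.sub_eq_zero_of_le hd]
      exact reach_zero (hI.mono Finset.subset_union_left) (hJ.mono Finset.subset_union_right)

/-- The gap profile of one side of a join whose other side has independence number `b`. -/
def joinGap (a b : ℕ) (g : ℕ → ℕ) (i : ℕ) : ℕ := if i = a ∧ a < b then a else g i

/-- Only the maximum size of the smaller side changes its gap: a smaller set that can afford to lose
everything already reaches a maximum set of its own side through ∅. -/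
theorem joinGap_le_iff {N a b e f i : ℕ} {g h : ℕ → ℕ} (hA : Summary G N A a e g)
    (hB : Summary G N B b f h) (hAB : Disjoint A B)
    (hj : ∀ x ∈ A, ∀ y ∈ B, G.Adj x y) (hd : d ≤ N) :
    joinGap a b g i ≤ d ↔ ∀ I, IndepIn G A I → I.card = i → Escapes G (A ∪ B) d I := by
  unfold joinGap
  split_ifs with hi
  · obtain ⟨rfl, hab⟩ := hi
    constructor
    · rintro h I hI rfl
      exact (escapes_join_iff hB hAB hj hI).2 (Or.inr ⟨h, hab⟩)
    · intro h
      obtain ⟨I, hI, hc⟩ := hA.exists_max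
      rcases (escapes_join_iff hB hAB hj hI).1 (h I hI hc) with ⟨J, hJ, hlt⟩ | h
      · have := hA.card_le J (hJ.indepIn hI)
        omega
      · omega
  · rw [hA.gap_iff i d hd]
    refine forall₃_congr fun I hI hc => ?_
    rw [escapes_join_iff hB hAB hj hI, or_iff_left_of_imp]
    rintro ⟨h1, h2⟩
    obtain ⟨J, hJ, hJc⟩ := hA.exists_max
    have := hA.card_le I hI
    refine ⟨J, ?_, by omega⟩
    rw [Nat.sub_eq_zero_of_le h1]
    exact reach_zero hI hJ

theorem Reach.join_iff_of_max {a : ℕ} (hAB : Disjoint A B) (hj : ∀ x ∈ A, ∀ y ∈ B, G.Adj x y)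
    (hI : IndepIn G A I) (hJ : IndepIn G A J) (hc : I.card = a) :
    Reach G (A ∪ B) (a - d) I J ↔ Reach G A (a - d) I J := by
  refine ⟨fun h => ?_, fun h => h.mono Finset.subset_union_left le_rfl⟩
  rcases Nat.eq_zero_or_pos (a - d) with h0 | h0
  · rw [h0]
    exact reach_zero hI hJ
  · exact h.of_join h0 hI (by omega) hAB hj

/-- The loss needed to connect the maximum independent sets of a join. -/
def joinSpread (a b e f : ℕ) : ℕ := if a < b then f else if b < a then e else a

theorem joinSpread_comm (a b e f : ℕ) : joinSpread a b e f = joinSpread b a f e := by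
  unfold joinSpread
  split_ifs <;> omega

/-- If `b < a`, all maximum sets lie in `A`. If `a = b`, there are maximum sets on both sides, and
passing between them through ∅ costs all `a` vertices. -/
theorem joinSpread_le_iff {N a b e f : ℕ} {g h : ℕ → ℕ} (hA : Summary G N A a e g)
    (hB : Summary G N B b f h) (hA0 : A.Nonempty) (hAB : Disjoint A B)
    (hj : ∀ x ∈ A, ∀ y ∈ B, G.Adj x y) (hba : b ≤ a) :
    joinSpread a b e f ≤ d ↔ ∀ I J, IndepIn G (A ∪ B) I → IndepIn G (A ∪ B) J →
      I.card = a → J.card = a → Reach G (A ∪ B) (a - d) I J := by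
  have ha := hA.pos hA0
  unfold joinSpread
  rw [if_neg hba.not_gt]
  split_ifs with hlt
  · have key : ∀ I, IndepIn G (A ∪ B) I → I.card = a → IndepIn G A I := fun I hI hc => by
      rcases hI.subset_or_subset hj with h | h
      · exact ⟨h, hI.2⟩
      · have := hB.card_le I ⟨h, hI.2⟩
        omega
    rw [hA.spread_iff]
    constructor
    · intro H I J hI hJ hIc hJc
      exact (H I J (key I hI hIc) (key J hJ hJc) hIc hJc).mono Finset.subset_union_left le_rfl
    · intro H I J hI hJ hIc hJc
      exact (Reach.join_iff_of_max hAB hj hI hJ hIc).1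
        (H I J (hI.mono Finset.subset_union_left) (hJ.mono Finset.subset_union_left) hIc hJc)
  · have hab : a = b := by omega
    subst hab
    constructor
    · intro had I J hI hJ _ _
      rw [Nat.sub_eq_zero_of_le had]
      exact reach_zero hI hJ
    · intro H
      by_contra! hd
      obtain ⟨I, hI, hIc⟩ := hA.exists_max
      obtain ⟨J, hJ, hJc⟩ := hB.exists_max
      have := (H I J (hI.mono Finset.subset_union_left) (hJ.mono Finset.subset_union_right)
        hIc hJc).of_join (by omega) hI (by omega) hAB hj
      obtain ⟨x, hx⟩ := Finset.card_pos.1 (hJc.symm ▸ ha)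
      exact Finset.disjoint_left.1 hAB ((this.indepIn hI).1 hx) (hJ.1 hx)

/-- Each independent set of the join belongs to one side, so the requirements of both sides must
hold at once; hence the maximum of the gaps. -/
theorem Summary.join {N a b e f : ℕ} {g h : ℕ → ℕ} (hA : Summary G N A a e g)
    (hB : Summary G N B b f h) (hA0 : A.Nonempty) (hB0 : B.Nonempty) (hAB : Disjoint A B)
    (hj : ∀ x ∈ A, ∀ y ∈ B, G.Adj x y) (haN : a ≤ N) (hbN : b ≤ N) :
    Summary G N (A ∪ B) (max a b) (joinSpread a b e f)
      (fun i => max (joinGap a b g i) (joinGap b a h i)) where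
  exists_max := by
    rcases le_total a b with hab | hab
    · obtain ⟨I, hI, hc⟩ := hB.exists_max
      exact ⟨I, hI.mono Finset.subset_union_right, by rw [hc, max_eq_right hab]⟩
    · obtain ⟨I, hI, hc⟩ := hA.exists_max
      exact ⟨I, hI.mono Finset.subset_union_left, by rw [hc, max_eq_left hab]⟩
  card_le I hI := by
    rcases hI.subset_or_subset hj with h | h
    · exact (hA.card_le I ⟨h, hI.2⟩).trans (le_max_left _ _)
    · exact (hB.card_le I ⟨h, hI.2⟩).trans (le_max_right _ _)
  gap_le i := by
    have h1 := hA.gap_le i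
    have h2 := hB.gap_le i
    unfold joinGap
    split_ifs <;> omega
  gap_iff i d hd := by
    have hj' : ∀ x ∈ B, ∀ y ∈ A, G.Adj x y := fun x hx y hy => (hj y hy x hx).symm
    rw [max_le_iff, joinGap_le_iff hA hB hAB hj hd, joinGap_le_iff hB hA hAB.symm hj' hd,
      Finset.union_comm B A]
    constructor
    · rintro ⟨H1, H2⟩ I hI hc
      rcases hI.subset_or_subset hj with h | h
      · exact H1 I ⟨h, hI.2⟩ hc
      · exact H2 I ⟨h, hI.2⟩ hc
    · intro H
      exact ⟨fun I hI => H I (hI.mono Finset.subset_union_left),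
        fun I hI => H I (hI.mono Finset.subset_union_right)⟩
  spread_iff d := by
    rcases le_total b a with hab | hab
    · rw [joinSpread_le_iff hA hB hA0 hAB hj hab, max_eq_left hab]
    · rw [joinSpread_comm, joinSpread_le_iff hB hA hB0 hAB.symm
        (fun x hx y hy => (hj y hy x hx).symm) hab, max_eq_right hab, Finset.union_comm B A]

end

/-! ### Connectedness of the token addition and removal graph -/

section

variable {V : Type*} [DecidableEq V] {G : SimpleGraph V}

theorem tarGraph_connected_of_nonpos {k : ℤ} (hk : k ≤ 0) : (tarGraph G k).Connected := by
  have key : ∀ I : KIndepSet G k, (tarGraph G k).Reachable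
      ⟨∅, by simp [SimpleGraph.IsIndepSet], by simpa using hk⟩ I := by
    rintro ⟨I, hI, hIk⟩
    induction I using Finset.induction_on with
    | empty => exact .refl _
    | insert u I hu ih =>
      have hI' : G.IsIndepSet (I : Set V) := hI.mono (by simp)
      exact (ih hI' (by omega)).trans (SimpleGraph.Adj.reachable ⟨u, Or.inl ⟨hu, rfl⟩⟩)
  rw [SimpleGraph.connected_iff]
  exact ⟨fun I J => (key I).symm.trans (key J),
    ⟨⟨∅, by simp [SimpleGraph.IsIndepSet], by simpa using hk⟩⟩⟩

variable [Fintype V]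

theorem reachable_tarGraph_iff {k : ℕ} (I J : KIndepSet G k) :
    (tarGraph G k).Reachable I J ↔ Reach G Finset.univ k I.1 J.1 := by
  rw [SimpleGraph.reachable_iff_reflTransGen]
  constructor
  · intro h
    induction h with
    | refl => exact .refl
    | @tail X Y _ hs ih =>
      exact ih.tail ⟨⟨Finset.subset_univ _, Y.2.1⟩, by exact_mod_cast Y.2.2, hs⟩
  · intro h
    obtain ⟨J, hJ⟩ := J
    change Reach G Finset.univ k I.1 J at h
    induction h with
    | refl => exact .refl
    | @tail X Y h hs ih =>
      have hX : G.IsIndepSet (X : Set V) := (Reach.indepIn h ⟨Finset.subset_univ _, I.2.1⟩).2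
      have hXc : k ≤ X.card := Reach.le_card h (by exact_mod_cast I.2.2)
      exact (ih ⟨hX, by exact_mod_cast hXc⟩).tail hs.2.2

/-- A set of size i may lose i - k vertices without falling below k. The inequality `e + k ≤ a` also
contains `k ≤ a`, that is, non-emptiness. -/
theorem Summary.tarGraph_connected_iff {N a e k : ℕ} {g : ℕ → ℕ}
    (h : Summary G N Finset.univ a e g) (haN : a ≤ N) :
    (tarGraph G k).Connected ↔ e + k ≤ a ∧ ∀ i, k ≤ i → i < a → g i + k ≤ i := by
  have he := h.spread_le
  have huniv : ∀ {I}, G.IsIndepSet ((I : Finset V) : Set V) → IndepIn G Finset.univ I :=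
    fun hI => ⟨Finset.subset_univ _, hI⟩
  constructor
  · intro hc
    have hr : ∀ I J, IndepIn G Finset.univ I → IndepIn G Finset.univ J → k ≤ I.card → k ≤ J.card →
        Reach G Finset.univ k I J := fun I J hI hJ hIc hJc =>
      (reachable_tarGraph_iff ⟨I, hI.2, by exact_mod_cast hIc⟩
        ⟨J, hJ.2, by exact_mod_cast hJc⟩).1 (hc.preconnected _ _)
    have hka : k ≤ a := by
      obtain ⟨I⟩ := hc.nonempty
      have h1 := h.card_le I.1 (huniv I.2.1)
      have h2 : k ≤ I.1.card := by exact_mod_cast I.2.2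
      omega
    constructor
    · have := (h.spread_iff (a - k)).2 fun I J hI hJ hIc hJc => by
        rw [Nat.sub_sub_self hka]
        exact hr I J hI hJ (by omega) (by omega)
      omega
    · intro i hki hia
      have := (h.gap_iff i (i - k) (by omega)).2 fun I hI hIc => by
        obtain ⟨J, hJ, hJc⟩ := h.exists_max
        refine ⟨J, ?_, by omega⟩
        rw [hIc, Nat.sub_sub_self hki]
        exact hr I J hI hJ (by omega) (by omega)
      omega
  · rintro ⟨h1, h2⟩
    obtain ⟨K, hK, hKc⟩ := h.exists_max
    -- Every set climbs to a maximum set, by induction on its deficit, and all maximum sets are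
    -- linked to `K`.
    have key : ∀ m I, IndepIn G Finset.univ I → k ≤ I.card → a - I.card ≤ m →
        Reach G Finset.univ k I K := by
      intro m
      induction m with
      | zero =>
        intro I hI hkI hm
        have := h.card_le I hI
        have hIc : I.card = a := by omega
        have := (h.spread_iff (a - k)).1 (by omega) I K hI hK hIc hKc
        rwa [Nat.sub_sub_self (by omega)] at this
      | succ m ih =>
        intro I hI hkI hm
        rcases (h.card_le I hI).eq_or_lt with hIc | hIc
        · have := (h.spread_iff (a - k)).1 (by omega) I K hI hK hIc hKc
          rwa [Nat.sub_sub_self (by omega)] at this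
        · have hg := h2 I.card hkI hIc
          obtain ⟨J, hJ, hlt⟩ := (h.gap_iff I.card (I.card - k) (by omega)).1 (by omega) I hI rfl
          rw [Nat.sub_sub_self hkI] at hJ
          exact hJ.trans (ih J (hJ.indepIn hI) (by omega) (by omega))
    have hKk : k ≤ K.card := by omega
    rw [SimpleGraph.connected_iff]
    refine ⟨fun I J => ?_, ⟨⟨K, hK.2, by exact_mod_cast hKk⟩⟩⟩
    rw [reachable_tarGraph_iff]
    exact (key _ I.1 (huniv I.2.1) (by exact_mod_cast I.2.2) le_rfl).trans
      ((key _ J.1 (huniv J.2.1) (by exact_mod_cast J.2.2) le_rfl).symm (huniv J.2.1)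
        (by exact_mod_cast J.2.2))

end

end IndepReconf

/-! ## Twins in cographs -/

section

variable {V : Type*} {G : SimpleGraph V}

theorem IsCograph.not_path (hG : IsCograph G) {a b c d : V} (hab : G.Adj a b) (hbc : G.Adj b c)
    (hcd : G.Adj c d) (hac : ¬ G.Adj a c) (had : ¬ G.Adj a d) (hbd : ¬ G.Adj b d) (hac' : a ≠ c)
    (had' : a ≠ d) (hbd' : b ≠ d) : False := by
  have key : ∀ i j, G.Adj (![a, b, c, d] i) (![a, b, c, d] j) ↔
      (SimpleGraph.pathGraph 4).Adj i j := by
    intro i j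
    simp only [SimpleGraph.pathGraph_adj]
    fin_cases i <;> fin_cases j <;> simp_all [G.adj_comm]
  refine hG ⟨⟨⟨![a, b, c, d], ?_⟩, key _ _⟩⟩
  intro i j h
  have h1 := hab.ne
  have h2 := hbc.ne
  have h3 := hcd.ne
  fin_cases i <;> fin_cases j <;> simp_all

theorem IsCograph.compl (hG : IsCograph G) : IsCograph Gᶜ := by
  rintro ⟨f⟩
  have key : ∀ i j : Fin 4, i ≠ j → (G.Adj (f i) (f j) ↔ ¬ (SimpleGraph.pathGraph 4).Adj i j) := by
    intro i j hij
    rw [← f.map_rel_iff, SimpleGraph.compl_adj]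
    have := f.injective.ne hij
    tauto
  have adj : ∀ i j : Fin 4, i ≠ j → ¬ (SimpleGraph.pathGraph 4).Adj i j → G.Adj (f i) (f j) :=
    fun i j h h' => (key i j h).2 h'
  have nadj : ∀ i j : Fin 4, (SimpleGraph.pathGraph 4).Adj i j → ¬ G.Adj (f i) (f j) :=
    fun i j h h' => (key i j h.ne).1 h' h
  -- The path on four vertices is self-complementary: the non-edges of 0–1–2–3 form the path
  -- 1–3–0–2.
  refine hG.not_path (a := f 1) (b := f 3) (c := f 0) (d := f 2) (adj _ _ ?_ ?_) (adj _ _ ?_ ?_)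
    (adj _ _ ?_ ?_) (nadj _ _ ?_) (nadj _ _ ?_) (nadj _ _ ?_) (f.injective.ne ?_)
    (f.injective.ne ?_) (f.injective.ne ?_) <;>
  simp [SimpleGraph.pathGraph_adj]

/-- Every other vertex of `S` is adjacent to both or to none of `u` and `v`. -/
def TwinsIn (G : SimpleGraph V) (S : Finset V) (u v : V) : Prop :=
  ∀ w ∈ S, w ≠ u → w ≠ v → (G.Adj w u ↔ G.Adj w v)

theorem TwinsIn.symm {S : Finset V} {u v : V}
    (h : TwinsIn G S u v) : TwinsIn G S v u :=
  fun w hw hv hu => (h w hw hu hv).symm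

variable [DecidableEq V]

/-- `S` splits into two nonempty parts with no edges between them. -/
def SplitsAsUnion (G : SimpleGraph V) (S : Finset V) : Prop :=
  ∃ A B, A.Nonempty ∧ B.Nonempty ∧ Disjoint A B ∧ A ∪ B = S ∧ ∀ x ∈ A, ∀ y ∈ B, ¬ G.Adj x y

/-- If `v` misses one part, the union still splits. Otherwise no neighbour of `v` is adjacent to a
non-neighbour, so either `v` is adjacent to everything, or its non-neighbours are separated from the
rest. -/
theorem splits_insert_of_union (hG : IsCograph G) {S : Finset V} {v : V} (hv : v ∉ S)
    (hS : SplitsAsUnion G S) : SplitsAsUnion G (insert v S) ∨ SplitsAsUnion Gᶜ (insert v S) := by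
  classical
  obtain ⟨A, B, hA, hB, hAB, rfl, hn⟩ := hS
  have hv' : v ∉ A ∧ v ∉ B := by simpa using hv
  by_cases h1 : ∀ x ∈ A, ¬ G.Adj v x
  · refine Or.inl ⟨A, insert v B, hA, ⟨v, by simp⟩, ?_, by simp, ?_⟩
    · simp [hAB, hv'.1]
    · intro x hx y hy
      rcases Finset.mem_insert.1 hy with rfl | hy
      · exact fun h => h1 x hx h.symm
      · exact hn x hx y hy
  by_cases h2 : ∀ x ∈ B, ¬ G.Adj v x
  · refine Or.inl ⟨insert v A, B, ⟨v, by simp⟩, hB, ?_, by simp, ?_⟩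
    · simp [hAB, hv'.2]
    · intro x hx y hy
      rcases Finset.mem_insert.1 hx with rfl | hx
      · exact h2 y hy
      · exact hn x hx y hy
  push Not at h1 h2
  obtain ⟨p, hpA, hp⟩ := h1
  obtain ⟨q, hqB, hq⟩ := h2
  have key : ∀ x ∈ A ∪ B, ∀ y ∈ A ∪ B, G.Adj v x → ¬ G.Adj v y → ¬ G.Adj x y := by
    intro x hx y hy hvx hvy hxy
    have hvy' : v ≠ y := fun h => hv (h ▸ hy)
    rcases Finset.mem_union.1 hx with hx | hx <;> rcases Finset.mem_union.1 hy with hy | hy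
    -- If x and y lie in the same part, then y – x – v – q, with `q` a neighbour of `v` in the other
    -- part, is an induced path.
    · exact hG.not_path hq.symm hvx hxy (fun h => hn x hx q hqB h.symm)
        (fun h => hn y hy q hqB h.symm) hvy (fun h => Finset.disjoint_left.1 hAB hx (h ▸ hqB))
        (fun h => Finset.disjoint_left.1 hAB hy (h ▸ hqB)) hvy'
    · exact hn x hx y hy hxy
    · exact hn y hy x hx hxy.symm
    · exact hG.not_path hp.symm hvx hxy (hn p hpA x hx)
        (hn p hpA y hy) hvy (fun h => Finset.disjoint_left.1 hAB hpA (h ▸ hx))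
        (fun h => Finset.disjoint_left.1 hAB hpA (h ▸ hy)) hvy'
  by_cases h3 : ∀ y ∈ A ∪ B, G.Adj v y
  · refine Or.inr ⟨{v}, A ∪ B, by simp, ⟨p, by simp [hpA]⟩, ?_, by simp, ?_⟩
    · simpa using hv
    · intro x hx y hy
      rw [Finset.mem_singleton.1 hx, SimpleGraph.compl_adj]
      exact fun h => h.2 (h3 y hy)
  · push Not at h3
    obtain ⟨y₀, hy₀, hvy₀⟩ := h3
    refine Or.inl ⟨insert v ((A ∪ B).filter (G.Adj v)), (A ∪ B).filter (fun y => ¬ G.Adj v y),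
      ⟨v, by simp⟩, ⟨y₀, by rw [Finset.mem_filter]; exact ⟨hy₀, hvy₀⟩⟩, ?_, ?_, ?_⟩
    · rw [Finset.disjoint_insert_left]
      refine ⟨fun h => hv (Finset.mem_filter.1 h).1, Finset.disjoint_filter_filter_not _ _ _⟩
    · rw [Finset.insert_union, Finset.filter_union_filter_not_eq]
    · intro x hx y hy
      rw [Finset.mem_filter] at hy
      rcases Finset.mem_insert.1 hx with rfl | hx
      · exact hy.2
      · rw [Finset.mem_filter] at hx
        exact key x hx.1 y hy.1 hx.2 hy.2

/-- A vertex set with at least two vertices of a cograph is disconnected or co-disconnected. -/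
theorem IsCograph.splits (hG : IsCograph G) (S : Finset V) (hS : 2 ≤ S.card) :
    SplitsAsUnion G S ∨ SplitsAsUnion Gᶜ S := by
  induction S using Finset.induction_on with
  | empty => simp at hS
  | insert v S hv ih =>
    rw [Finset.card_insert_of_notMem hv] at hS
    rcases Nat.lt_or_ge S.card 2 with h | h
    · obtain ⟨w, rfl⟩ := Finset.card_eq_one.1 (show S.card = 1 by omega)
      have hvw : v ≠ w := by simpa using hv
      by_cases hadj : G.Adj v w
      · exact Or.inr ⟨{v}, {w}, by simp, by simp, by simpa using hvw, rfl, by simp [hadj]⟩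
      · exact Or.inl ⟨{v}, {w}, by simp, by simp, by simpa using hvw, rfl, by simpa using hadj⟩
    · rcases ih h with h | h
      · exact splits_insert_of_union hG hv h
      · have := splits_insert_of_union hG.compl hv h
        rwa [compl_compl, or_comm] at this

theorem TwinsIn.of_compl {S : Finset V} {u v : V} (h : TwinsIn Gᶜ S u v) : TwinsIn G S u v := by
  intro w hw hu hv
  have := h w hw hu hv
  simp only [SimpleGraph.compl_adj] at this
  tauto

/-- Twins of one part remain twins, since the other part is adjacent to neither. If both parts are
single vertices, these are twins because no third vertex exists. -/
theorem exists_twins_of_splits {S : Finset V} (hS : SplitsAsUnion G S)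
    (ih : ∀ T ⊂ S, 2 ≤ T.card → ∃ u ∈ T, ∃ v ∈ T, u ≠ v ∧ TwinsIn G T u v) :
    ∃ u ∈ S, ∃ v ∈ S, u ≠ v ∧ TwinsIn G S u v := by
  obtain ⟨A, B, hA, hB, hAB, rfl, hn⟩ := hS
  have key : ∀ {C D : Finset V}, D.Nonempty → Disjoint C D → (∀ x ∈ C, ∀ y ∈ D, ¬ G.Adj x y) →
      C ∪ D = A ∪ B → 2 ≤ C.card → ∃ u ∈ A ∪ B, ∃ v ∈ A ∪ B, u ≠ v ∧ TwinsIn G (A ∪ B) u v := by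
    intro C D hD hCD hn hU hC
    rw [← hU] at ih ⊢
    obtain ⟨u, hu, v, hv, huv, ht⟩ := ih C (by
      rw [Finset.ssubset_iff_of_subset Finset.subset_union_left]
      obtain ⟨x, hx⟩ := hD
      exact ⟨x, by simp [hx], Finset.disjoint_right.1 hCD hx⟩) hC
    refine ⟨u, by simp [hu], v, by simp [hv], huv, ?_⟩
    intro w hw hwu hwv
    rcases Finset.mem_union.1 hw with hw | hw
    · exact ht w hw hwu hwv
    · exact iff_of_false (fun h => hn u hu w hw h.symm) (fun h => hn v hv w hw h.symm)
  by_cases hA2 : 2 ≤ A.card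
  · exact key hB hAB hn rfl hA2
  by_cases hB2 : 2 ≤ B.card
  · exact key hA hAB.symm (fun x hx y hy h => hn y hy x hx h.symm) (Finset.union_comm _ _) hB2
  obtain ⟨a, rfl⟩ := Finset.card_eq_one.1
    (show A.card = 1 by have := Finset.card_pos.2 hA; omega)
  obtain ⟨b, rfl⟩ := Finset.card_eq_one.1
    (show B.card = 1 by have := Finset.card_pos.2 hB; omega)
  refine ⟨a, by simp, b, by simp, by simpa using hAB, ?_⟩
  intro w hw hwa hwb
  simp [hwa, hwb] at hw

/-- A vertex set with at least two vertices of a cograph contains a pair of twins. -/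
theorem IsCograph.exists_twins (hG : IsCograph G) (S : Finset V) (hS : 2 ≤ S.card) :
    ∃ u ∈ S, ∃ v ∈ S, u ≠ v ∧ TwinsIn G S u v := by
  induction S using Finset.strongInduction with
  | H S ih =>
    rcases hG.splits S hS with h | h
    · exact exists_twins_of_splits h ih
    -- Being twins is invariant under complementation, so the disconnected case is applied to `Gᶜ`.
    · obtain ⟨u, hu, v, hv, huv, ht⟩ := exists_twins_of_splits h fun T hT hT2 => by
        obtain ⟨u, hu, v, hv, huv, ht⟩ := ih T hT hT2
        exact ⟨u, hu, v, hv, huv, TwinsIn.of_compl (by rwa [compl_compl])⟩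
      exact ⟨u, hu, v, hv, huv, ht.of_compl⟩

end

/-! ## Reasoning about programs -/

namespace Ram

/-- Started in `σ`, the program halts within `T` operations in a memory satisfying `Q`. -/
def Runs (W : ℤ) (P : Program) (σ : State) (T : ℕ) (Q : State → Prop) : Prop :=
  ∃ t τ, Exec W P σ t τ ∧ t ≤ T ∧ Q τ

/-- The variables that a program may write. -/
@[simp] def Program.varWrites : Program → List ℕ
  | .skip => []
  | .assign x _ => [x]
  | .store _ _ _ => []
  | .seq p q => p.varWrites ++ q.varWrites
  | .ite _ p q => p.varWrites ++ q.varWrites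
  | .while _ p => p.varWrites

/-- The arrays that a program may write. -/
@[simp] def Program.arrWrites : Program → List ℕ
  | .skip => []
  | .assign _ _ => []
  | .store a _ _ => [a]
  | .seq p q => p.arrWrites ++ q.arrWrites
  | .ite _ p q => p.arrWrites ++ q.arrWrites
  | .while _ p => p.arrWrites

/-- The memories `σ` and `τ` agree on everything that `P` does not write. -/
structure Frame (P : Program) (σ τ : State) : Prop where
  var : ∀ x, x ∉ P.varWrites → τ.var x = σ.var x
  arr : ∀ a, a ∉ P.arrWrites → τ.arr a = σ.arr a

@[simp] theorem State.setVar_var (σ : State) (x y : ℕ) (v : ℤ) :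
    (σ.setVar x v).var y = if y = x then v else σ.var y := by
  simp [State.setVar, Function.update_apply]

@[simp] theorem State.setVar_arr (σ : State) (x : ℕ) (v : ℤ) : (σ.setVar x v).arr = σ.arr := rfl

@[simp] theorem State.setArr_var (σ : State) (a : ℕ) (i v : ℤ) : (σ.setArr a i v).var = σ.var := rfl

@[simp] theorem State.setArr_arr (σ : State) (a b : ℕ) (i j v : ℤ) :
    (σ.setArr a i v).arr b j = if b = a then if j = i then v else σ.arr a j else σ.arr b j := by
  simp only [State.setArr, Function.update_apply]
  split_ifs with h <;> simp_all

/-- This lets postconditions mention only what a program changes; the syntax preserves the rest. -/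
theorem Exec.frame {W : ℤ} {P : Program} {σ τ : State} {t : ℕ} (h : Exec W P σ t τ) :
    Frame P σ τ := by
  induction h with
  | skip σ => exact ⟨fun _ _ => rfl, fun _ _ => rfl⟩
  | assign σ x e hv =>
    exact ⟨fun y hy => by simp_all [Program.varWrites], fun _ _ => rfl⟩
  | store σ a i e hi hv =>
    refine ⟨fun _ _ => rfl, fun b hb => ?_⟩
    have : b ≠ a := by simpa [Program.arrWrites] using hb
    simp [State.setArr, this]
  | seq _ _ ih₁ ih₂ =>
    refine ⟨fun x hx => ?_, fun a ha => ?_⟩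
    · simp only [Program.varWrites, List.mem_append, not_or] at hx
      rw [ih₂.var x hx.2, ih₁.var x hx.1]
    · simp only [Program.arrWrites, List.mem_append, not_or] at ha
      rw [ih₂.arr a ha.2, ih₁.arr a ha.1]
  | ite_true _ _ ih =>
    refine ⟨fun x hx => ?_, fun a ha => ?_⟩
    · simp only [Program.varWrites, List.mem_append, not_or] at hx
      exact ih.var x hx.1
    · simp only [Program.arrWrites, List.mem_append, not_or] at ha
      exact ih.arr a ha.1
  | ite_false _ _ ih =>
    refine ⟨fun x hx => ?_, fun a ha => ?_⟩
    · simp only [Program.varWrites, List.mem_append, not_or] at hx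
      exact ih.var x hx.2
    · simp only [Program.arrWrites, List.mem_append, not_or] at ha
      exact ih.arr a ha.2
  | while_false _ => exact ⟨fun _ _ => rfl, fun _ _ => rfl⟩
  | while_true _ _ _ ih₁ ih₂ =>
    refine ⟨fun x hx => ?_, fun a ha => ?_⟩
    · rw [ih₂.var x hx, ih₁.var x hx]
    · rw [ih₂.arr a ha, ih₁.arr a ha]

section

variable {W : ℤ} {P P' : Program} {σ : State} {T T' : ℕ} {Q R : State → Prop}

theorem Runs.mono (h : Runs W P σ T Q) (hT : T ≤ T') (hQ : ∀ τ, Frame P σ τ → Q τ → R τ) :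
    Runs W P σ T' R := by
  obtain ⟨t, τ, he, ht, hq⟩ := h
  exact ⟨t, τ, he, ht.trans hT, hQ τ he.frame hq⟩

theorem Runs.seq (h : Runs W P σ T R) (h' : ∀ τ, Frame P σ τ → R τ → Runs W P' τ T' Q) :
    Runs W (.seq P P') σ (T + T') Q := by
  obtain ⟨t, τ, he, ht, hr⟩ := h
  obtain ⟨t', υ, he', ht', hq⟩ := h' τ he.frame hr
  exact ⟨t + t', υ, .seq he he', Nat.add_le_add ht ht', hq⟩

theorem Runs.ite {b : Test} (h : b.Holds σ → Runs W P σ T Q)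
    (h' : ¬ b.Holds σ → Runs W P' σ T' Q) :
    Runs W (.ite b P P') σ (b.cost + 1 + max T T') Q := by
  by_cases hb : b.Holds σ
  · obtain ⟨t, τ, he, ht, hq⟩ := h hb
    exact ⟨_, τ, .ite_true hb he, by omega, hq⟩
  · obtain ⟨t, τ, he, ht, hq⟩ := h' hb
    exact ⟨_, τ, .ite_false hb he, by omega, hq⟩

/-- The weakest precondition of a loop-free program. -/
def Program.wp (W : ℤ) : Program → State → (State → Prop) → Prop
  | .skip, σ, Q => Q σ
  | .assign x e, σ, Q => |e.eval σ| ≤ W ∧ Q (σ.setVar x (e.eval σ))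
  | .store a i e, σ, Q =>
    |i.eval σ| ≤ W ∧ |e.eval σ| ≤ W ∧ Q (σ.setArr a (i.eval σ) (e.eval σ))
  | .seq p q, σ, Q => p.wp W σ fun τ => q.wp W τ Q
  | .ite b p q, σ, Q => (b.Holds σ → p.wp W σ Q) ∧ (¬ b.Holds σ → q.wp W σ Q)
  | .while _ _, _, _ => False

/-- The worst-case cost of a loop-free program. -/
def Program.cost : Program → ℕ
  | .skip => 1
  | .assign _ e => e.cost + 1
  | .store _ i e => i.cost + e.cost + 1
  | .seq p q => p.cost + q.cost
  | .ite b p q => b.cost + 1 + max p.cost q.cost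
  | .while _ _ => 0

/-- Loops have the precondition `False`, so the cost 0 assigned to them is never used. -/
theorem Runs.of_wp (h : P.wp W σ Q) : Runs W P σ P.cost Q := by
  induction P generalizing σ Q with
  | skip => exact ⟨_, _, .skip σ, le_rfl, h⟩
  | assign x e => exact ⟨_, _, .assign σ x e h.1, le_rfl, h.2⟩
  | store a i e => exact ⟨_, _, .store σ a i e h.1 h.2.1, le_rfl, h.2.2⟩
  | seq p q ihp ihq => exact (ihp h).seq fun τ _ hτ => ihq hτ
  | ite b p q ihp ihq => exact Runs.ite (fun hb => ihp (h.1 hb)) fun hb => ihq (h.2 hb)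
  | _ => exact False.elim h

/-- `for x = 0, 1, …` as long as `x < b`. -/
def Program.for (x : ℕ) (b : Expr) (p : Program) : Program :=
  .seq (.assign x (.const 0))
    (.while (.lt (.var x) b) (.seq p (.assign x (.add (.var x) (.const 1)))))

@[simp] theorem Program.varWrites_for (x : ℕ) (b : Expr) (p : Program) :
    (Program.for x b p).varWrites = x :: (p.varWrites ++ [x]) := rfl

@[simp] theorem Program.arrWrites_for (x : ℕ) (b : Expr) (p : Program) :
    (Program.for x b p).arrWrites = p.arrWrites := by
  simp [Program.for]

theorem Runs.while_of_invariant {x : ℕ} {b : Expr} {p : Program} {N T : ℕ}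
    (Inv : ℕ → State → Prop) (hx : x ∉ p.varWrites) (hN : (N : ℤ) ≤ W)
    (hb : ∀ τ, Frame (.for x b p) σ τ → ∀ i : ℕ, (i : ℤ) < b.eval τ ↔ i < N)
    (hstep : ∀ i < N, ∀ τ, Frame (.for x b p) σ τ → τ.var x = i → Inv i τ →
      Runs W p τ T fun υ => Inv (i + 1) (υ.setVar x (i + 1)))
    (m i : ℕ) (hi : i + m = N) (τ : State) (hτ : Frame (.for x b p) σ τ) (hxi : τ.var x = i)
    (h : Inv i τ) :
    Runs W (.while (.lt (.var x) b) (.seq p (.assign x (.add (.var x) (.const 1))))) τ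
      (m * (T + b.cost + 7) + (b.cost + 3)) (Inv N) := by
  induction m generalizing i τ with
  | zero =>
    obtain rfl : i = N := hi
    have hne : ¬ Test.Holds τ (.lt (.var x) b) := by
      simp only [Test.Holds, Expr.eval, hxi, hb τ hτ]
      omega
    exact ⟨_, τ, .while_false hne, by simp only [Test.cost, Expr.cost]; omega, h⟩
  | succ m ih =>
    have hiN : i < N := by omega
    have hlt : Test.Holds τ (.lt (.var x) b) := by
      simpa only [Test.Holds, Expr.eval, hxi, hb τ hτ]
    obtain ⟨t, υ, he, ht, hυ⟩ := hstep i hiN τ hτ hxi h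
    have hυx : υ.var x = i := by rw [he.frame.var x hx, hxi]
    have hev : (Expr.add (.var x) (.const 1)).eval υ = i + 1 := by simp [Expr.eval, hυx]
    have hea : Exec W (.assign x (.add (.var x) (.const 1))) υ _ _ :=
      .assign υ x _ (by rw [hev, abs_of_nonneg (by positivity)]; omega)
    rw [hev] at hea
    have hfr : Frame (.for x b p) σ (υ.setVar x (i + 1)) := by
      refine ⟨fun y hy => ?_, fun a ha => ?_⟩
      · have hy' := hy
        simp only [Program.for, Program.varWrites, List.mem_append, List.mem_singleton,
          not_or] at hy'
        rw [State.setVar_var, if_neg hy'.1, he.frame.var y hy'.2.1, hτ.var y hy]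
      · have ha' := ha
        simp only [Program.for, Program.arrWrites, List.nil_append,
          List.append_nil] at ha'
        rw [State.setVar_arr, he.frame.arr a ha', hτ.arr a ha]
    obtain ⟨s, ω, hw, hs, hω⟩ := ih (i + 1) (by omega) _ hfr (by simp) hυ
    refine ⟨_, ω, .while_true hlt (.seq he hea) hw, ?_, hω⟩
    simp only [Test.cost, Expr.cost]
    rw [Nat.succ_mul]
    omega

/-- Each round pays b.cost + 3 for the test and 4 for the increment; the initial assignment (2) and
the failing test (b.cost + 3) are paid once. -/
theorem Runs.for {x : ℕ} {b : Expr} {p : Program} {N T : ℕ} (Inv : ℕ → State → Prop)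
    (hx : x ∉ p.varWrites) (hN : (N : ℤ) ≤ W)
    (hb : ∀ τ, Frame (.for x b p) σ τ → ∀ i : ℕ, (i : ℤ) < b.eval τ ↔ i < N)
    (h0 : Inv 0 (σ.setVar x 0))
    (hstep : ∀ i < N, ∀ τ, Frame (.for x b p) σ τ → τ.var x = i → Inv i τ →
      Runs W p τ T fun υ => Inv (i + 1) (υ.setVar x (i + 1))) :
    Runs W (.for x b p) σ (N * (T + b.cost + 7) + (b.cost + 5)) (Inv N) := by
  have hW : (0 : ℤ) ≤ W := le_trans (by positivity) hN
  have h1 : Runs W (.assign x (.const 0)) σ 2 (fun τ => τ = σ.setVar x 0) :=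
    ⟨_, _, .assign σ x _ (by simpa [Expr.eval] using hW), by simp [Expr.cost], rfl⟩
  refine (h1.seq (T' := N * (T + b.cost + 7) + (b.cost + 3)) (Q := Inv N) ?_).mono (by omega)
    fun _ _ h => h
  rintro _ - rfl
  refine Runs.while_of_invariant Inv hx hN hb hstep N 0 (by omega) _ ?_ (by simp) h0
  refine ⟨fun y hy => ?_, fun a ha => rfl⟩
  simp only [Program.for, Program.varWrites, List.mem_append, List.mem_singleton, not_or] at hy
  rw [State.setVar_var, if_neg hy.1]

end

end Ram

/-! ## The program

The variables are `x₀ = n` and `x₁ = k`, the vertices `x₂` (being added or removed), `x₅` and `x₆`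
(twins to be merged), and auxiliary ones. The arrays are the adjacency matrix `A₀`, the number `A₁`
of distinguishing vertices for each pair, the marks `A₂` of removed vertices, and the summary of
the module of each vertex: independence number `A₃`, spread `A₄`, gap profile `A₅`. -/

namespace Ram

/-- The position of row `i`, column `j` in a matrix with `len` columns. -/
def idx (i len j : Expr) : Expr := .add (.mul i len) j

/-- The length of a gap profile. -/
def gapLen : Expr := .add (.var 0) (.const 1)

/-- The square of the difference of the entries `x` and `y` of row `x₂` of the adjacency matrix. -/
def sqDiff : Expr :=
  .mul (.sub (.read 0 (idx (.var 2) (.var 0) (.var 3))) (.read 0 (idx (.var 2) (.var 0) (.var 4))))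
    (.sub (.read 0 (idx (.var 2) (.var 0) (.var 3))) (.read 0 (idx (.var 2) (.var 0) (.var 4))))

/-- Adds `s` to the count of every pair distinguished by the vertex `x₂`. -/
def addDiff (s : ℤ) : Program :=
  .for 3 (.var 0) (.for 4 (.var 0)
    (.store 1 (idx (.var 3) (.var 0) (.var 4))
      (.add (.read 1 (idx (.var 3) (.var 0) (.var 4))) (.mul (.const s) sqDiff))))

/-- Sets up the summaries of the single vertices and the counts. -/
def setup : Program :=
  .for 2 (.var 0) (.seq
    (.seq (.store 3 (.var 2) (.const 1)) (.store 5 (idx (.var 2) gapLen (.const 1)) gapLen))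
    (addDiff 1))

/-- `x₄` and `x₃` are present, and twins. -/
def isTwins : Test :=
  .and (.and (.eq (.read 2 (.var 3)) (.const 0)) (.eq (.read 2 (.var 4)) (.const 0)))
    (.eq (.read 1 (idx (.var 3) (.var 0) (.var 4)))
      (.mul (.const 2) (.read 0 (idx (.var 3) (.var 0) (.var 4)))))

/-- Finds twins `x₅ < x₆`. -/
def findTwins : Program :=
  .for 3 (.var 0) (.for 4 (.var 3)
    (.ite isTwins (.seq (.assign 5 (.var 4)) (.assign 6 (.var 3))) .skip))

/-- One term of the gap profile of a disjoint union. -/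
def unionTerm : Program :=
  .seq (.assign 10 (.read 5 (idx (.var 5) gapLen (.var 4))))
    (.seq (.assign 11 (.read 5 (idx (.var 6) gapLen (.sub (.var 7) (.var 4)))))
      (.seq (.ite (.lt (.var 11) (.var 10)) (.assign 10 (.var 11)) .skip)
        (.ite (.lt (.var 8) (.var 10)) (.assign 8 (.var 10)) .skip)))

/-- Computes the gap profile of the disjoint union of two modules in place, from the top. -/
def unionGap : Program :=
  .for 3 gapLen
    (.seq (.seq (.assign 7 (.sub (.var 0) (.var 3))) (.assign 8 (.const 0)))
      (.seq (.for 4 (.add (.var 7) (.const 1)) unionTerm)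
        (.store 5 (idx (.var 5) gapLen (.var 7)) (.var 8))))

/-- Computes the summary of the disjoint union of two modules. -/
def mergeUnion : Program :=
  .seq (.seq (.ite (.lt (.read 4 (.var 5)) (.read 4 (.var 6)))
      (.store 4 (.var 5) (.read 4 (.var 6))) .skip)
    (.store 3 (.var 5) (.add (.read 3 (.var 5)) (.read 3 (.var 6))))) unionGap

/-- Computes the pointwise maximum of two gap profiles in place. -/
def maxGap : Program :=
  .for 3 gapLen (.ite
    (.lt (.read 5 (idx (.var 5) gapLen (.var 3))) (.read 5 (idx (.var 6) gapLen (.var 3))))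
    (.store 5 (idx (.var 5) gapLen (.var 3)) (.read 5 (idx (.var 6) gapLen (.var 3)))) .skip)

/-- Computes the summary of the join of two modules. -/
def mergeJoin : Program :=
  .seq (.ite (.lt (.read 3 (.var 5)) (.read 3 (.var 6)))
    (.seq (.store 5 (idx (.var 5) gapLen (.read 3 (.var 5))) (.read 3 (.var 5)))
      (.seq (.store 3 (.var 5) (.read 3 (.var 6))) (.store 4 (.var 5) (.read 4 (.var 6)))))
    (.ite (.lt (.read 3 (.var 6)) (.read 3 (.var 5)))
      (.store 5 (idx (.var 6) gapLen (.read 3 (.var 6))) (.read 3 (.var 6)))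
      (.store 4 (.var 5) (.read 3 (.var 5))))) maxGap

/-- Merges a pair of twins. -/
def mergeTwins : Program :=
  .seq findTwins
    (.seq (.ite (.eq (.read 0 (idx (.var 5) (.var 0) (.var 6))) (.const 0)) mergeUnion mergeJoin)
      (.seq (.seq (.assign 2 (.var 6)) (.store 2 (.var 6) (.const 1))) (addDiff (-1))))

/-- Decides from the summary of the whole graph whether the answer is positive. -/
def readAnswer : Program :=
  .seq (.ite (.lt (.read 3 (.const 0)) (.add (.read 4 (.const 0)) (.var 1)))
      (.assign 7 (.const 0)) (.assign 7 (.const 1)))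
    (.seq (.for 3 gapLen (.ite
      (.and (.and (.not (.lt (.var 3) (.var 1))) (.lt (.var 3) (.read 3 (.const 0))))
        (.lt (.var 3) (.add (.read 5 (.var 3)) (.var 1)))) (.assign 7 (.const 0)) .skip))
      (.assign 0 (.var 7)))

/-- The decision procedure. -/
def decideConnected : Program :=
  .ite (.lt (.const 0) (.var 1))
    (.seq setup
      (.seq (.for 9 (.sub (.var 0) (.const 1)) mergeTwins) readAnswer))
    (.assign 0 (.const 1))

/-! ### Array addresses, word size, and the update of the distinguishing counts -/

section

variable {W : ℤ} {n : ℕ} {σ : State}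

theorem abs_idx_le {i L j : ℤ} (hW : ((n : ℤ) + 2) ^ 2 ≤ W) (hi : 0 ≤ i) (hin : i < n)
    (hj : 0 ≤ j) (hjL : j < L) (hL : L ≤ n + 1) : |i * L + j| ≤ W := by
  rw [abs_of_nonneg (by nlinarith)]
  nlinarith

/-- Row-by-row addresses do not collide, so writing one matrix entry leaves all others intact. -/
theorem idx_inj {i i' j j' : ℕ} {L : ℤ} (hj : j < L) (hj' : j' < L) :
    (i : ℤ) * L + j = i' * L + j' ↔ i = i' ∧ j = j' := by
  constructor
  · intro h
    have hi : i = i' := by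
      by_contra hne
      rcases lt_or_gt_of_ne hne with hlt | hlt
      · have : (i : ℤ) + 1 ≤ i' := by exact_mod_cast hlt
        nlinarith
      · have : (i' : ℤ) + 1 ≤ i := by exact_mod_cast hlt
        nlinarith
    subst hi
    exact ⟨rfl, by exact_mod_cast (add_left_cancel h : (j : ℤ) = j')⟩
  · rintro ⟨rfl, rfl⟩
    rfl

theorem abs_le_of_sq_le {z : ℤ} (hW : ((n : ℤ) + 2) ^ 2 ≤ W) (hz : 0 ≤ z) (hzn : z ≤ n + 1) :
    |z| ≤ W := by
  rw [abs_of_nonneg hz]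
  nlinarith

theorem natCast_le_of_sq_le {m : ℕ} (hW : ((n : ℤ) + 2) ^ 2 ≤ W) (hm : m ≤ n + 1) :
    (m : ℤ) ≤ W := by
  have : (m : ℤ) ≤ n + 1 := by exact_mod_cast hm
  nlinarith

/-- Whether the vertex `w` distinguishes `x` and `y`, for adjacency matrix `A`. -/
def diff (A : ℤ → ℤ) (n w x y : ℕ) : ℤ :=
  (A (w * n + x) - A (w * n + y)) * (A (w * n + x) - A (w * n + y))

theorem runs_addDiff {s : ℤ} {w : ℕ} (hW : ((n : ℤ) + 2) ^ 2 ≤ W) (hn : σ.var 0 = n)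
    (hw : σ.var 2 = w)
    (hD : ∀ x < n, ∀ y < n, |σ.arr 1 (x * n + y) + s * diff (σ.arr 0) n w x y| ≤ W) :
    Runs W (addDiff s) σ (100 * (n + 1) ^ 2) fun τ =>
      ∀ x < n, ∀ y < n, τ.arr 1 (x * n + y) =
        σ.arr 1 (x * n + y) + s * diff (σ.arr 0) n w x y := by
  have hNW : (n : ℤ) ≤ W := natCast_le_of_sq_le hW (by omega)
  -- The pairs lexicographically before (x, y) are already updated.
  let I : ℕ → ℕ → State → Prop := fun x y τ => ∀ x' < n, ∀ y' < n, τ.arr 1 (x' * n + y') =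
    σ.arr 1 (x' * n + y') + if x' < x ∨ x' = x ∧ y' < y then s * diff (σ.arr 0) n w x' y' else 0
  refine (Runs.for (N := n) (T := n * 50 + 6) (fun x => I x 0) (by simp) hNW ?_ ?_ ?_).mono ?_ ?_
  · intro τ hτ i
    simp [Expr.eval, hτ.var 0 (by simp), hn]
  · simp [I]
  · intro x hx τ hτ hτx hI
    refine (Runs.for (N := n) (T := 42) (I x) (by simp) hNW ?_ hI ?_).mono ?_ ?_
    · intro υ hυ i
      simp [Expr.eval, hυ.var 0 (by simp), hτ.var 0 (by simp), hn]
    · intro y hy υ hυ hυy hI'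
      have e0 : υ.var 0 = n := by rw [hυ.var 0 (by simp), hτ.var 0 (by simp), hn]
      have e2 : υ.var 2 = w := by rw [hυ.var 2 (by simp), hτ.var 2 (by simp), hw]
      have e3 : υ.var 3 = x := by rw [hυ.var 3 (by simp), hτx]
      have eA : υ.arr 0 = σ.arr 0 := by rw [hυ.arr 0 (by simp), hτ.arr 0 (by simp)]
      have e1 := hI' x hx y hy
      rw [if_neg (by omega), add_zero] at e1
      have hd := hD x hx y hy
      refine (Runs.of_wp ?_).mono (by simp [Program.cost, Expr.cost, idx, sqDiff]) fun _ _ h => h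
      simp only [Program.wp, Expr.eval, idx, sqDiff, e0, e2, e3, eA, hυy, e1]
      refine ⟨abs_idx_le hW (by omega) (by omega) (by omega) (by omega) (by omega), hd, ?_⟩
      intro x' hx' y' hy'
      simp only [State.setVar_arr, State.setArr_arr, if_true,
        idx_inj (show (y' : ℤ) < n by omega) (show (y : ℤ) < n by omega)]
      by_cases h : x' = x ∧ y' = y
      · obtain ⟨rfl, rfl⟩ := h
        simp [diff]
      · rw [if_neg (by omega), hI' x' hx' y' hy']
        congr 1
        exact if_congr (by omega) rfl rfl
    · simp only [Expr.cost]
      omega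
    · intro υ _ hI' x' hx' y' hy'
      rw [State.setVar_arr, hI' x' hx' y' hy']
      congr 1
      exact if_congr (by omega) rfl rfl
  · simp only [Expr.cost]
    nlinarith
  · intro τ _ hI x hx y hy
    rw [hI x hx y hy, if_pos (Or.inl hx)]

end

end Ram

/-! ### Correctness of the setup, the twin search and the merging of summaries -/

namespace Ram

open IndepReconf

section

variable {W : ℤ} {n : ℕ} {σ : State}

theorem diff_nonneg (A : ℤ → ℤ) (n w x y : ℕ) : 0 ≤ diff A n w x y :=
  mul_self_nonneg _

theorem diff_le_one {A : ℤ → ℤ} (hA : ∀ z, A z = 0 ∨ A z = 1) (n w x y : ℕ) :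
    diff A n w x y ≤ 1 := by
  unfold diff
  rcases hA (w * n + x) with h | h <;> rcases hA (w * n + y) with h' | h' <;> simp [h, h']

theorem abs_sum_diff_le {ι : Type*} {A : ℤ → ℤ} (hA : ∀ z, A z = 0 ∨ A z = 1)
    (hW : ((n : ℤ) + 2) ^ 2 ≤ W) (s : Finset ι) (f : ι → ℕ) (hs : s.card ≤ n) (x y : ℕ) :
    |∑ w ∈ s, diff A n (f w) x y| ≤ W := by
  refine abs_le_of_sq_le hW (Finset.sum_nonneg fun w _ => diff_nonneg _ _ _ _ _) ?_
  have := Finset.sum_le_card_nsmul s (fun w => diff A n (f w) x y) 1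
    fun w _ => diff_le_one hA _ _ _ _
  rw [nsmul_eq_mul, mul_one] at this
  have : (s.card : ℤ) ≤ n := by exact_mod_cast hs
  omega

theorem runs_setup (hW : ((n : ℤ) + 2) ^ 2 ≤ W) (hn : σ.var 0 = n)
    (hA : ∀ z, σ.arr 0 z = 0 ∨ σ.arr 0 z = 1) (h1 : σ.arr 1 = 0) (h3 : σ.arr 3 = 0)
    (h5 : σ.arr 5 = 0) :
    Runs W setup σ (200 * (n + 1) ^ 3) fun τ =>
      (∀ x < n, ∀ y < n, τ.arr 1 (x * n + y) = ∑ w ∈ Finset.range n, diff (σ.arr 0) n w x y) ∧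
      (∀ v : ℕ, τ.arr 3 v = if v < n then 1 else 0) ∧
      ∀ v < n, ∀ i ≤ n, τ.arr 5 (v * (n + 1) + i) = if i = 1 then (n : ℤ) + 1 else 0 := by
  have hNW : (n : ℤ) ≤ W := natCast_le_of_sq_le hW (by omega)
  let I : ℕ → State → Prop := fun w τ =>
    (∀ x < n, ∀ y < n, τ.arr 1 (x * n + y) = ∑ w ∈ Finset.range w, diff (σ.arr 0) n w x y) ∧
    (∀ v : ℕ, τ.arr 3 v = if v < w then 1 else 0) ∧
    ∀ v < n, ∀ i ≤ n, τ.arr 5 (v * (n + 1) + i) = if v < w ∧ i = 1 then (n : ℤ) + 1 else 0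
  refine (Runs.for (N := n) (T := 14 + 100 * (n + 1) ^ 2) I (by simp [addDiff]) hNW ?_ ?_
    ?_).mono ?_ ?_
  · intro τ hτ i
    simp [Expr.eval, hτ.var 0 (by simp [addDiff]), hn]
  · simp [I, h1, h3, h5]
  · rintro w hw τ hτ hτw ⟨i1, i3, i5⟩
    have e0 : τ.var 0 = n := by rw [hτ.var 0 (by simp [addDiff]), hn]
    have eA : τ.arr 0 = σ.arr 0 := hτ.arr 0 (by simp [addDiff])
    refine Runs.seq (R := fun υ => (∀ v : ℕ, υ.arr 3 v = if v < w + 1 then 1 else 0) ∧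
      ∀ v < n, ∀ i ≤ n, υ.arr 5 (v * (n + 1) + i) = if v < w + 1 ∧ i = 1 then (n : ℤ) + 1 else 0)
      ((Runs.of_wp ?_).mono (by simp [Program.cost, Expr.cost, idx, gapLen]) fun _ _ h => h) ?_
    · simp only [Program.wp, Expr.eval, idx, gapLen, State.setArr_var, e0, hτw]
      refine ⟨abs_le_of_sq_le hW (by omega) (by omega), abs_le_of_sq_le hW (by omega) (by omega),
        abs_idx_le hW (by omega) (by omega) (by omega) (by omega) (by omega),
        abs_le_of_sq_le hW (by omega) (by omega), ?_, ?_⟩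
      · intro v
        simp only [State.setArr_arr, if_true, Nat.cast_inj, i3]
        split_ifs <;> omega
      · intro v hv i hi
        have := idx_inj (i := v) (i' := w) (j := i) (j' := 1) (L := n + 1) (by omega) (by omega)
        simp only [Nat.cast_one] at this
        simp only [State.setArr_arr, if_true, this, i5 v hv i hi]
        split_ifs <;> omega
    · rintro υ hυ ⟨j3, j5⟩
      have e1 : υ.arr 1 = τ.arr 1 := hυ.arr 1 (by simp)
      have eA' : υ.arr 0 = σ.arr 0 := by rw [hυ.arr 0 (by simp), eA]
      refine (runs_addDiff (w := w) hW (by rw [hυ.var 0 (by simp), e0])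
        (by rw [hυ.var 2 (by simp), hτw]) ?_).mono le_rfl ?_
      · intro x hx y hy
        rw [e1, eA', i1 x hx y hy, one_mul, ← Finset.sum_range_succ]
        exact abs_sum_diff_le hA hW _ _ (by simpa using hw) _ _
      · intro ω hω hD
        refine ⟨?_, ?_, ?_⟩
        · intro x hx y hy
          rw [State.setVar_arr, hD x hx y hy, e1, eA', i1 x hx y hy, one_mul,
            Finset.sum_range_succ]
        · rw [State.setVar_arr, hω.arr 3 (by simp [addDiff])]
          exact j3
        · rw [State.setVar_arr, hω.arr 5 (by simp [addDiff])]
          exact j5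
  · simp only [Expr.cost]
    rw [pow_succ (n + 1) 2]
    have : 1 ≤ (n + 1) ^ 2 := Nat.one_le_pow _ _ (by omega)
    generalize (n + 1) ^ 2 = m at *
    nlinarith
  · rintro τ - ⟨i1, i3, i5⟩
    refine ⟨i1, i3, fun v hv i hi => ?_⟩
    rw [i5 v hv i hi]
    exact if_congr (by tauto) rfl rfl

/-- The vertices `a < b` are present and recognized as twins. -/
structure TwinCode (n : ℕ) (σ : State) (a b : ℕ) : Prop where
  lt : a < b
  lt_card : b < n
  left : σ.arr 2 a = 0
  right : σ.arr 2 b = 0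
  count : σ.arr 1 (b * n + a) = 2 * σ.arr 0 (b * n + a)

theorem runs_findTwins (hW : ((n : ℤ) + 2) ^ 2 ≤ W) (hn : σ.var 0 = n)
    (h : ∃ a b, TwinCode n σ a b) :
    Runs W findTwins σ (100 * (n + 1) ^ 2) fun τ =>
      ∃ a b : ℕ, TwinCode n σ a b ∧ τ.var 5 = a ∧ τ.var 6 = b := by
  have hNW : (n : ℤ) ≤ W := natCast_le_of_sq_le hW (by omega)
  -- Before the first hit `x₅` and `x₆` carry no information, hence an implication. Later hits may
  -- overwrite earlier ones; any pair will do.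
  let I : ℕ → ℕ → State → Prop := fun x y τ =>
    (∃ a b, (b < x ∨ b = x ∧ a < y) ∧ TwinCode n σ a b) →
      ∃ a b : ℕ, TwinCode n σ a b ∧ τ.var 5 = a ∧ τ.var 6 = b
  refine (Runs.for (N := n) (T := n * 60 + 6) (fun x => I x 0) (by simp) hNW ?_ ?_ ?_).mono ?_ ?_
  · intro τ hτ i
    simp [Expr.eval, hτ.var 0 (by simp), hn]
  · rintro ⟨a, b, h, -⟩
    omega
  · intro x hx τ hτ hτx hI
    refine (Runs.for (N := x) (T := 52) (I x) (by simp) (by omega) ?_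
      (fun h => by simpa using hI h) ?_).mono ?_ ?_
    · intro υ hυ i
      simp [Expr.eval, hυ.var 3 (by simp), hτx]
    · intro y hy υ hυ hυy hI'
      have e0 : υ.var 0 = n := by rw [hυ.var 0 (by simp), hτ.var 0 (by simp), hn]
      have e3 : υ.var 3 = x := by rw [hυ.var 3 (by simp), hτx]
      have eA : ∀ a, υ.arr a = σ.arr a := fun a => by rw [hυ.arr a (by simp), hτ.arr a (by simp)]
      refine (Runs.of_wp ?_).mono
        (by simp [Program.cost, Expr.cost, Test.cost, idx, isTwins]) fun _ _ h => h
      simp only [Program.wp, Expr.eval, Test.Holds, isTwins, idx, e0, e3, eA, hυy]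
      refine ⟨fun hc => ⟨abs_le_of_sq_le hW (by omega) (by omega),
        abs_le_of_sq_le hW (by simp [e3]) (by simp [e3]; omega), fun _ => ?_⟩, fun hc => ?_⟩
      · exact ⟨y, x, ⟨hy, hx, hc.1.2, hc.1.1, hc.2⟩, by simp, by simp [e3]⟩
      · rintro ⟨a, b, hab, ht⟩
        refine (hI' ?_)
        refine ⟨a, b, ?_, ht⟩
        by_contra hne
        have hbx : b = x := by omega
        have hay : a = y := by omega
        subst hbx hay
        exact hc ⟨⟨ht.right, ht.left⟩, ht.count⟩
    · simp only [Expr.cost]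
      omega
    · rintro υ hυ hI' ⟨a, b, hab, ht⟩
      have := ht.lt
      exact hI' ⟨a, b, by omega, ht⟩
  · simp only [Expr.cost]
    nlinarith
  · intro τ _ hI
    obtain ⟨a, b, ht⟩ := h
    exact hI ⟨a, b, Or.inl ht.lt_card, ht⟩

/-- The gap profile of a disjoint union. -/
def unionProfile (p q : ℕ → ℕ) (s : ℕ) : ℕ :=
  (Finset.range (s + 1)).sup fun i => min (p i) (q (s - i))

/-- Row `v` of the gap profiles is `p`. -/
def HasGap (n : ℕ) (σ : State) (v : ℕ) (p : ℕ → ℕ) : Prop :=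
  ∀ i ≤ n, σ.arr 5 (v * (n + 1) + i) = p i

/-- The memories `σ` and `τ` hold the same gap profile of `x`. -/
def SameGap (n : ℕ) (σ τ : State) (x : ℕ) : Prop :=
  ∀ i ≤ n, τ.arr 5 (x * (n + 1) + i) = σ.arr 5 (x * (n + 1) + i)

theorem runs_unionGap {u v : ℕ} {p q : ℕ → ℕ} (hW : ((n : ℤ) + 2) ^ 2 ≤ W) (hn : σ.var 0 = n)
    (hu : σ.var 5 = u) (hv : σ.var 6 = v) (hun : u < n) (hvn : v < n) (huv : u ≠ v)
    (hp : HasGap n σ u p) (hq : HasGap n σ v q) (hpn : ∀ i, p i ≤ n + 1) (hqn : ∀ i, q i ≤ n + 1) :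
    Runs W unionGap σ (200 * (n + 1) ^ 2) fun τ =>
      HasGap n τ u (unionProfile p q) ∧ ∀ x < n, x ≠ u → SameGap n σ τ x := by
  have hNW : ((n + 1 : ℕ) : ℤ) ≤ W := natCast_le_of_sq_le hW le_rfl
  have hconv : ∀ s t, (Finset.range t).sup (fun i => min (p i) (q (s - i))) ≤ n + 1 :=
    fun s t => Finset.sup_le fun i _ => (min_le_left _ _).trans (hpn i)
  -- The top r entries are new. The entry at s uses only old entries with index at most s, so
  -- overwriting from the top is safe.
  let I : ℕ → State → Prop := fun r τ =>
    (∀ i ≤ n, τ.arr 5 (u * (n + 1) + i) = if n < i + r then unionProfile p q i else p i) ∧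
      ∀ x < n, x ≠ u → SameGap n σ τ x
  refine (Runs.for (N := n + 1) (T := 6 + (((n + 1) * 60 + 10) + 10)) I (by simp [unionTerm]) hNW
    ?_ ?_ ?_).mono ?_ ?_
  · intro τ hτ i
    simp only [Expr.eval, gapLen, hτ.var 0 (by simp [unionTerm]), hn]
    omega
  · refine ⟨fun i hi => ?_, fun x _ _ i _ => rfl⟩
    rw [if_neg (by omega)]
    exact hp i hi
  · rintro r hr τ hτ hτr ⟨hI, hI'⟩
    have e0 : τ.var 0 = n := by rw [hτ.var 0 (by simp [unionTerm]), hn]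
    have e5 : τ.var 5 = u := by rw [hτ.var 5 (by simp [unionTerm]), hu]
    have e6 : τ.var 6 = v := by rw [hτ.var 6 (by simp [unionTerm]), hv]
    obtain ⟨s, hs⟩ : ∃ s, s + r = n := ⟨n - r, by omega⟩
    refine Runs.seq (R := fun υ => υ.var 7 = s ∧ υ.var 8 = 0) ((Runs.of_wp ?_).mono
      (by simp [Program.cost, Expr.cost]) fun _ _ h => h) ?_
    · simp only [Program.wp, Expr.eval, e0, hτr]
      have : (n : ℤ) - r = s := by omega
      rw [this]
      exact ⟨abs_le_of_sq_le hW (by omega) (by omega), abs_le_of_sq_le hW (by omega) (by omega),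
        by simp, by simp⟩
    rintro υ hυ ⟨e7, e8⟩
    have f0 : υ.var 0 = n := by rw [hυ.var 0 (by simp), e0]
    have f5 : υ.var 5 = u := by rw [hυ.var 5 (by simp), e5]
    have f6 : υ.var 6 = v := by rw [hυ.var 6 (by simp), e6]
    have fA : υ.arr 5 = τ.arr 5 := hυ.arr 5 (by simp)
    refine Runs.seq (R := fun ω => ω.var 8 = unionProfile p q s) ((Runs.for (N := s + 1) (T := 50)
      (fun i ω => ω.var 8 = ((Finset.range i).sup fun i => min (p i) (q (s - i)) : ℕ))
      (by simp [unionTerm]) (by omega) ?_ ?_ ?_).mono ?_ ?_) ?_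
    · intro ω hω i
      simp only [Expr.eval, hω.var 7 (by simp [unionTerm]), e7]
      omega
    -- The supremum over the empty range is 0, the initial value of `x₈`.
    · simp [e8]
    · intro i hi ω hω hωi h8
      have g0 : ω.var 0 = n := by rw [hω.var 0 (by simp [unionTerm]), f0]
      have g5 : ω.var 5 = u := by rw [hω.var 5 (by simp [unionTerm]), f5]
      have g6 : ω.var 6 = v := by rw [hω.var 6 (by simp [unionTerm]), f6]
      have g7 : ω.var 7 = s := by rw [hω.var 7 (by simp [unionTerm]), e7]
      have gA : ω.arr 5 = τ.arr 5 := by rw [hω.arr 5 (by simp [unionTerm]), fA]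
      have hpi : τ.arr 5 (u * (n + 1) + i) = p i := by rw [hI i (by omega), if_neg (by omega)]
      have hsi : (s : ℤ) - i = (s - i : ℕ) := by omega
      have hqi : τ.arr 5 (v * (n + 1) + (s - i : ℕ)) = q (s - i) := by
        rw [hI' v hvn huv.symm _ (by omega), hq _ (by omega)]
      refine (Runs.of_wp ?_).mono
        (by simp [Program.cost, Expr.cost, Test.cost, idx, gapLen, unionTerm]) fun _ _ h => h
      have hb1 := hpn i
      have hb2 := hqn (s - i)
      have hb3 := hconv s i
      rw [Finset.range_add_one, Finset.sup_insert]
      generalize (Finset.range i).sup (fun i => min (p i) (q (s - i))) = m at *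
      simp [Program.wp, Expr.eval, Test.Holds, unionTerm, idx, gapLen, g0, g5, g6, g7, gA, hωi,
        hpi, hsi, hqi, h8]
      have w1 : ((p i : ℕ) : ℤ) ≤ W := natCast_le_of_sq_le hW hb1
      have w2 : ((q (s - i) : ℕ) : ℤ) ≤ W := natCast_le_of_sq_le hW hb2
      omega
    · simp only [Expr.cost]
      have : (s + 1) * (50 + (1 + 1 + 1) + 7) ≤ (n + 1) * 60 := Nat.mul_le_mul (by omega) (by omega)
      omega
    · exact fun ω _ h => h
    · intro ω hω h8
      have g0 : ω.var 0 = n := by rw [hω.var 0 (by simp [unionTerm]), f0]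
      have g5 : ω.var 5 = u := by rw [hω.var 5 (by simp [unionTerm]), f5]
      have g7 : ω.var 7 = s := by rw [hω.var 7 (by simp [unionTerm]), e7]
      have gA : ω.arr 5 = τ.arr 5 := by rw [hω.arr 5 (by simp [unionTerm]), fA]
      refine (Runs.of_wp ?_).mono (by simp [Program.cost, Expr.cost, idx, gapLen]) fun _ _ h => h
      simp only [Program.wp, Expr.eval, idx, gapLen, g0, g5, g7, h8]
      refine ⟨abs_idx_le hW (by omega) (by omega) (by omega) (by omega) (by omega),
        abs_le_of_sq_le hW (by omega) (by exact_mod_cast hconv s (s + 1)), ?_, ?_⟩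
      · intro i hi
        simp only [State.setVar_arr, State.setArr_arr, if_true, gA, hI i hi,
          idx_inj (show (i : ℤ) < n + 1 by omega) (show (s : ℤ) < n + 1 by omega), true_and]
        by_cases h : i = s
        · subst h
          rw [if_pos rfl, if_pos (by omega)]
        · rw [if_neg h, if_congr (show n < i + r ↔ n < i + (r + 1) by omega) rfl rfl]
      · intro x hx hxu i hi
        simp only [State.setVar_arr, State.setArr_arr, if_true, gA,
          idx_inj (show (i : ℤ) < n + 1 by omega) (show (s : ℤ) < n + 1 by omega), hxu, false_and,
          if_false]
        exact hI' x hx hxu i hi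
  · simp only [Expr.cost, gapLen]
    nlinarith
  · rintro τ - ⟨hI, hI'⟩
    refine ⟨fun i hi => ?_, hI'⟩
    rw [hI i hi, if_pos (by omega)]

theorem runs_maxGap {u v : ℕ} {p q : ℕ → ℕ} (hW : ((n : ℤ) + 2) ^ 2 ≤ W) (hn : σ.var 0 = n)
    (hu : σ.var 5 = u) (hv : σ.var 6 = v) (hun : u < n) (hvn : v < n) (huv : u ≠ v)
    (hp : HasGap n σ u p) (hq : HasGap n σ v q) (hqn : ∀ i, q i ≤ n + 1) :
    Runs W maxGap σ (100 * (n + 1) ^ 2) fun τ =>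
      HasGap n τ u (fun i => max (p i) (q i)) ∧ ∀ x < n, x ≠ u → SameGap n σ τ x := by
  have hNW : ((n + 1 : ℕ) : ℤ) ≤ W := natCast_le_of_sq_le hW le_rfl
  let I : ℕ → State → Prop := fun r τ =>
    (∀ i ≤ n, τ.arr 5 (u * (n + 1) + i) = if i < r then max (p i) (q i) else p i) ∧
      ∀ x < n, x ≠ u → SameGap n σ τ x
  refine (Runs.for (N := n + 1) (T := 60) I (by simp) hNW ?_ ?_ ?_).mono ?_ ?_
  · intro τ hτ i
    simp only [Expr.eval, gapLen, hτ.var 0 (by simp), hn]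
    omega
  · refine ⟨fun i hi => ?_, fun x _ _ i _ => rfl⟩
    rw [if_neg (by omega)]
    exact hp i hi
  · rintro r hr τ hτ hτr ⟨hI, hI'⟩
    have e0 : τ.var 0 = n := by rw [hτ.var 0 (by simp), hn]
    have e5 : τ.var 5 = u := by rw [hτ.var 5 (by simp), hu]
    have e6 : τ.var 6 = v := by rw [hτ.var 6 (by simp), hv]
    have hpr : τ.arr 5 (u * (n + 1) + r) = p r := by rw [hI r (by omega), if_neg (by omega)]
    have hqr : τ.arr 5 (v * (n + 1) + r) = q r := by
      rw [hI' v hvn huv.symm r (by omega), hq r (by omega)]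
    refine (Runs.of_wp ?_).mono
      (by simp [Program.cost, Expr.cost, Test.cost, idx, gapLen]) fun _ _ h => h
    simp only [Program.wp, Expr.eval, Test.Holds, idx, gapLen, e0, e5, e6, hτr, hpr, hqr]
    refine ⟨fun hlt => ⟨abs_idx_le hW (by omega) (by omega) (by omega) (by omega) (by omega),
      abs_le_of_sq_le hW (by omega) (by exact_mod_cast hqn r), ?_, ?_⟩, fun hlt => ⟨?_, ?_⟩⟩
    · intro i hi
      simp only [State.setVar_arr, State.setArr_arr, if_true, hI i hi,
        idx_inj (show (i : ℤ) < n + 1 by omega) (show (r : ℤ) < n + 1 by omega), true_and]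
      by_cases h : i = r
      · subst h
        rw [if_pos rfl, if_pos (by omega)]
        omega
      · rw [if_neg h]
        split_ifs <;> omega
    · intro x hx hxu i hi
      simp only [State.setVar_arr, State.setArr_arr, if_true,
        idx_inj (show (i : ℤ) < n + 1 by omega) (show (r : ℤ) < n + 1 by omega), hxu, false_and,
        if_false]
      exact hI' x hx hxu i hi
    · intro i hi
      rw [State.setVar_arr, hI i hi]
      by_cases h : i = r
      · subst h
        rw [if_neg (by omega), if_pos (by omega)]
        omega
      · split_ifs <;> omega
    · exact hI'
  · simp only [Expr.cost, gapLen]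
    nlinarith
  · rintro τ - ⟨hI, hI'⟩
    refine ⟨fun i hi => ?_, hI'⟩
    rw [hI i hi, if_pos (by omega)]

variable {G : SimpleGraph (Fin n)} {A B : Finset (Fin n)}

/-- The memory holds a summary of `M` for the vertex `v`. -/
def HasSummary (G : SimpleGraph (Fin n)) (σ : State) (v : ℕ) (M : Finset (Fin n)) : Prop :=
  ∃ a e g, Summary G n M a e g ∧ σ.arr 3 v = (a : ℕ) ∧ σ.arr 4 v = (e : ℕ) ∧ HasGap n σ v g

/-- The memories `σ` and `τ` hold the same summary for the vertex `x`. -/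
structure SameSummary (n : ℕ) (σ τ : State) (x : ℕ) : Prop where
  alpha : τ.arr 3 x = σ.arr 3 x
  spread : τ.arr 4 x = σ.arr 4 x
  gap : SameGap n σ τ x

theorem HasSummary.congr {τ : State} {v : ℕ} {M : Finset (Fin n)} (h : HasSummary G σ v M)
    (hs : SameSummary n σ τ v) : HasSummary G τ v M := by
  obtain ⟨a, e, g, h, ha, he, hg⟩ := h
  exact ⟨a, e, g, h, hs.alpha.trans ha, hs.spread.trans he,
    fun i hi => (hs.gap i hi).trans (hg i hi)⟩

theorem Summary.alpha_le {M : Finset (Fin n)} {N a e : ℕ} {g : ℕ → ℕ} (h : Summary G N M a e g) :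
    a ≤ n := by
  obtain ⟨I, -, rfl⟩ := h.exists_max
  simpa using Finset.card_le_univ I

theorem runs_mergeUnion {u v : ℕ} (hW : ((n : ℤ) + 2) ^ 2 ≤ W) (hn : σ.var 0 = n)
    (hu : σ.var 5 = u) (hv : σ.var 6 = v) (hun : u < n) (hvn : v < n) (huv : u ≠ v)
    (hA : HasSummary G σ u A) (hB : HasSummary G σ v B) (hAB : Disjoint A B)
    (hnon : ∀ x ∈ A, ∀ y ∈ B, ¬ G.Adj x y) :
    Runs W mergeUnion σ (300 * (n + 1) ^ 2) fun τ =>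
      HasSummary G τ u (A ∪ B) ∧ ∀ x < n, x ≠ u → x ≠ v → SameSummary n σ τ x := by
  obtain ⟨a, e, p, sA, ha, he, hp⟩ := hA
  obtain ⟨b, f, q, sB, hb, hf, hq⟩ := hB
  have han := Summary.alpha_le sA
  have hbn := Summary.alpha_le sB
  have hen := sA.spread_le
  have hfn := sB.spread_le
  refine (Runs.seq (T := 50) (T' := 200 * (n + 1) ^ 2) (R := fun τ => τ.arr 3 u = (a + b : ℕ) ∧
    τ.arr 4 u = (max e f : ℕ) ∧ ∀ x : ℕ, x ≠ u → τ.arr 3 x = σ.arr 3 x ∧ τ.arr 4 x = σ.arr 4 x)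
    ((Runs.of_wp ?_).mono (by simp [Program.cost, Expr.cost, Test.cost]) fun _ _ h => h) ?_).mono
    (by nlinarith) fun _ _ h => h
  · have hab : |(a : ℤ) + b| ≤ W := by
      rw [abs_of_nonneg (by positivity)]
      nlinarith
    simp only [Program.wp, Expr.eval, Test.Holds, hu, hv, ha, hb, he, hf, State.setArr_var]
    refine ⟨fun hlt => ⟨abs_le_of_sq_le hW (by omega) (by omega),
      abs_le_of_sq_le hW (by omega) (by omega), ?_⟩, fun hlt => ?_⟩ <;>
    · simp +contextual [ha, hb, he, hab]
      exact ⟨natCast_le_of_sq_le hW (by omega), by omega⟩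
  · rintro τ hτ ⟨h3, h4, h34⟩
    have e5 : τ.arr 5 = σ.arr 5 := hτ.arr 5 (by simp)
    refine (runs_unionGap (p := p) (q := q) hW (by rw [hτ.var 0 (by simp), hn])
      (by rw [hτ.var 5 (by simp), hu]) (by rw [hτ.var 6 (by simp), hv]) hun hvn huv
      (by unfold HasGap; rwa [e5]) (by unfold HasGap; rwa [e5]) sA.gap_le sB.gap_le).mono le_rfl ?_
    rintro υ hυ ⟨hg, hs⟩
    have f3 : υ.arr 3 = τ.arr 3 := hυ.arr 3 (by simp [unionGap, unionTerm])
    have f4 : υ.arr 4 = τ.arr 4 := hυ.arr 4 (by simp [unionGap, unionTerm])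
    refine ⟨⟨a + b, max e f, unionProfile p q, ?_, by rw [f3, h3], by rw [f4, h4], hg⟩, ?_⟩
    · refine sA.union sB hAB hnon (fun s => ?_) fun s d hd => ?_
      · exact Finset.sup_le fun i _ => (min_le_left _ _).trans (sA.gap_le i)
      · simp only [unionProfile, Finset.sup_le_iff, Finset.mem_range, min_le_iff]
        constructor
        · rintro h i j rfl
          simpa using h i (by omega)
        · exact fun h i hi => h i (s - i) (by omega)
    · intro x hx hxu _
      refine ⟨by rw [f3, (h34 x hxu).1], by rw [f4, (h34 x hxu).2], fun i hi => ?_⟩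
      rw [hs x hx hxu i hi, e5]

theorem runs_mergeJoin {u v : ℕ} (hW : ((n : ℤ) + 2) ^ 2 ≤ W) (hn : σ.var 0 = n)
    (hu : σ.var 5 = u) (hv : σ.var 6 = v) (hun : u < n) (hvn : v < n) (huv : u ≠ v)
    (hA : HasSummary G σ u A) (hB : HasSummary G σ v B) (hA0 : A.Nonempty) (hB0 : B.Nonempty)
    (hAB : Disjoint A B) (hadj : ∀ x ∈ A, ∀ y ∈ B, G.Adj x y) :
    Runs W mergeJoin σ (300 * (n + 1) ^ 2) fun τ =>
      HasSummary G τ u (A ∪ B) ∧ ∀ x < n, x ≠ u → x ≠ v → SameSummary n σ τ x := by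
  obtain ⟨a, e, p, sA, ha, he, hp⟩ := hA
  obtain ⟨b, f, q, sB, hb, hf, hq⟩ := hB
  have han := Summary.alpha_le sA
  have hbn := Summary.alpha_le sB
  have hen := sA.spread_le
  have hfn := sB.spread_le
  refine (Runs.seq (T := 50) (T' := 100 * (n + 1) ^ 2) (R := fun τ => τ.arr 3 u = (max a b : ℕ) ∧
    τ.arr 4 u = (joinSpread a b e f : ℕ) ∧ HasGap n τ u (joinGap a b p) ∧
    HasGap n τ v (joinGap b a q) ∧ ∀ x < n, x ≠ u → x ≠ v → SameSummary n σ τ x)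
    ((Runs.of_wp ?_).mono (by simp [Program.cost, Expr.cost, Test.cost, idx, gapLen])
      fun _ _ h => h) ?_).mono (by nlinarith) fun _ _ h => h
  · have hu' : |(u : ℤ)| ≤ W := abs_le_of_sq_le hW (by omega) (by omega)
    have ha' : |(a : ℤ)| ≤ W := abs_le_of_sq_le hW (by omega) (by omega)
    have hb' : |(b : ℤ)| ≤ W := abs_le_of_sq_le hW (by omega) (by omega)
    have hf' : |(f : ℤ)| ≤ W := abs_le_of_sq_le hW (by omega) (by omega)
    have hi : ∀ {i j x y : ℕ}, i ≤ n → j ≤ n →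
        ((x : ℤ) * (n + 1) + i = y * (n + 1) + j ↔ x = y ∧ i = j) :=
      fun hi hj => idx_inj (by omega) (by omega)
    -- All three branches fit one description: at most one profile cell changes, the one at the
    -- maximum size of the strictly smaller side. Row `v` may be spoiled, because `v` is about to be
    -- removed.
    have key : ∀ τ : State, τ.arr 3 u = (max a b : ℕ) → τ.arr 4 u = (joinSpread a b e f : ℕ) →
        (∀ x : ℕ, x ≠ u → τ.arr 3 x = σ.arr 3 x ∧ τ.arr 4 x = σ.arr 4 x) →
        (∀ x : ℕ, ∀ i ≤ n, τ.arr 5 (x * (n + 1) + i) =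
          if x = u ∧ i = a ∧ a < b then (a : ℤ) else if x = v ∧ i = b ∧ b < a then (b : ℤ)
          else σ.arr 5 (x * (n + 1) + i)) → τ.arr 3 u = (max a b : ℕ) ∧
        τ.arr 4 u = (joinSpread a b e f : ℕ) ∧ HasGap n τ u (joinGap a b p) ∧
        HasGap n τ v (joinGap b a q) ∧ ∀ x < n, x ≠ u → x ≠ v → SameSummary n σ τ x := by
      intro τ h3 h4 h34 h5
      refine ⟨h3, h4, fun i hi => ?_, fun i hi => ?_, fun x hx hxu hxv => ?_⟩
      · rw [h5 u i hi, hp i hi, joinGap]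
        simp only [true_and, huv, false_and, if_false]
        split_ifs <;> rfl
      · rw [h5 v i hi, hq i hi, joinGap]
        simp only [true_and, huv.symm, false_and, if_false]
        split_ifs <;> rfl
      · refine ⟨(h34 x hxu).1, (h34 x hxu).2, fun i hi => ?_⟩
        rw [h5 x i hi, if_neg (by tauto), if_neg (by tauto)]
    simp only [Program.wp, Expr.eval, Test.Holds, hu, hv, ha, hb, State.setArr_var,
      gapLen, idx, hn, Nat.cast_lt]
    have hne : ((v : ℤ) = u) = False := by simpa using huv.symm
    refine ⟨fun hlt => ⟨abs_idx_le hW (by omega) (by omega) (by omega) (by omega) (by omega), ha',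
      hu', ?_, hu', ?_, key _ ?_ ?_ ?_ ?_⟩, fun hlt => ⟨fun hlt' =>
      ⟨abs_idx_le hW (by omega) (by omega) (by omega) (by omega) (by omega), hb',
        key _ ?_ ?_ ?_ ?_⟩,
      fun hlt' => ⟨hu', ha', key _ ?_ ?_ ?_ ?_⟩⟩⟩
    · simpa [hb] using hb'
    · simpa [hf] using hf'
    · simp [hb, hlt.le]
    · simp [hf, joinSpread, hlt]
    · intro x hx
      simp [hx]
    · intro x i hxi
      simp [hi hxi han, hlt, hlt.not_gt]
    · simp [ha, hlt'.le]
    · simp [he, joinSpread, hlt, hlt']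
    · intro x hx
      simp
    · intro x i hxi
      simp [hi hxi hbn, hlt, hlt']
    · simp [ha, not_lt.1 hlt]
    · simp [joinSpread, hlt, hlt']
    · intro x hx
      simp [hx]
    · intro x i hxi
      simp [hlt, hlt']
  · rintro τ hτ ⟨h3, h4, hgu, hgv, hs⟩
    have g1 : ∀ i, joinGap b a q i ≤ n + 1 := fun i => by
      have := sB.gap_le i
      unfold joinGap
      split_ifs <;> omega
    refine (runs_maxGap hW (by rw [hτ.var 0 (by simp), hn])
      (by rw [hτ.var 5 (by simp), hu]) (by rw [hτ.var 6 (by simp), hv]) hun hvn huv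
      hgu hgv g1).mono le_rfl ?_
    rintro υ hυ ⟨hg, hs'⟩
    have f3 : υ.arr 3 = τ.arr 3 := hυ.arr 3 (by simp [maxGap])
    have f4 : υ.arr 4 = τ.arr 4 := hυ.arr 4 (by simp [maxGap])
    refine ⟨⟨_, _, _, sA.join sB hA0 hB0 hAB hadj han hbn, by rw [f3, h3], by rw [f4, h4], hg⟩, ?_⟩
    intro x hx hxu hxv
    have := hs x hx hxu hxv
    exact ⟨by rw [f3, this.alpha], by rw [f4, this.spread],
      fun i hi => (hs' x hx hxu i hi).trans (this.gap i hi)⟩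

end

end Ram

/-! ### Recognition of twins, the partition into modules, and the merging loop -/

namespace Ram

open IndepReconf

/-- `A` is the adjacency matrix of `G`, row by row. -/
structure IsAdjArray {n : ℕ} (G : SimpleGraph (Fin n)) (A : ℤ → ℤ) : Prop where
  zero_or_one : ∀ z, A z = 0 ∨ A z = 1
  eq_one_iff : ∀ i j : Fin n, A ((i : ℕ) * n + (j : ℕ)) = 1 ↔ G.Adj i j

section

variable {W : ℤ} {n : ℕ} {σ τ : State} {G : SimpleGraph (Fin n)} {A : ℤ → ℤ}

theorem IsAdjArray.eq_zero_iff (hA : IsAdjArray G A) (i j : Fin n) :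
    A ((i : ℕ) * n + (j : ℕ)) = 0 ↔ ¬ G.Adj i j := by
  rw [← hA.eq_one_iff]
  rcases hA.zero_or_one ((i : ℕ) * n + (j : ℕ)) with h | h <;> simp [h]

theorem IsAdjArray.diff_eq_zero_iff (hA : IsAdjArray G A) (w x y : Fin n) :
    diff A n w x y = 0 ↔ (G.Adj w x ↔ G.Adj w y) := by
  rw [diff, mul_self_eq_zero, sub_eq_zero, ← hA.eq_one_iff, ← hA.eq_one_iff]
  rcases hA.zero_or_one ((w : ℕ) * n + (x : ℕ)) with h | h <;>
    rcases hA.zero_or_one ((w : ℕ) * n + (y : ℕ)) with h' | h' <;> simp [h, h']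

/-- The vertices `u` and `v` themselves contribute one adjacency entry each, which makes up the
right-hand side. The remaining terms are non-negative, so they sum to zero exactly when no other
vertex distinguishes the pair. -/
theorem IsAdjArray.sum_diff_eq_iff (hA : IsAdjArray G A) {S : Finset (Fin n)} {u v : Fin n}
    (hu : u ∈ S) (hv : v ∈ S) (huv : u ≠ v) :
    ∑ w ∈ S, diff A n w v u = 2 * A ((v : ℕ) * n + (u : ℕ)) ↔ TwinsIn G S u v := by
  have hsymm : A ((u : ℕ) * n + (v : ℕ)) = A ((v : ℕ) * n + (u : ℕ)) := by
    have h1 := hA.eq_one_iff u v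
    have h2 := hA.eq_one_iff v u
    rw [G.adj_comm] at h1
    rcases hA.zero_or_one ((v : ℕ) * n + (u : ℕ)) with h | h <;>
      rcases hA.zero_or_one ((u : ℕ) * n + (v : ℕ)) with h' | h' <;> simp_all
  have hvv : A ((v : ℕ) * n + (v : ℕ)) = 0 := (hA.eq_zero_iff v v).2 (G.loopless.irrefl v)
  have huu : A ((u : ℕ) * n + (u : ℕ)) = 0 := (hA.eq_zero_iff u u).2 (G.loopless.irrefl u)
  have d1 : diff A n v v u = A ((v : ℕ) * n + (u : ℕ)) := by
    rw [diff, hvv]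
    rcases hA.zero_or_one ((v : ℕ) * n + (u : ℕ)) with h | h <;> simp [h]
  have d2 : diff A n u v u = A ((v : ℕ) * n + (u : ℕ)) := by
    rw [diff, huu, hsymm]
    rcases hA.zero_or_one ((v : ℕ) * n + (u : ℕ)) with h | h <;> simp [h]
  rw [← Finset.add_sum_erase S _ hv, ← Finset.add_sum_erase (S.erase v) _
    (Finset.mem_erase.2 ⟨huv, hu⟩), d1, d2, two_mul, ← add_assoc, add_eq_left,
    Finset.sum_eq_zero_iff_of_nonneg fun w _ => diff_nonneg _ _ _ _ _]
  constructor
  · intro h w hw hwu hwv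
    exact ((hA.diff_eq_zero_iff w v u).1
      (h w (Finset.mem_erase.2 ⟨hwu, Finset.mem_erase.2 ⟨hwv, hw⟩⟩))).symm
  · intro h w hw
    simp only [Finset.mem_erase] at hw
    exact (hA.diff_eq_zero_iff w v u).2 (h w hw.2.2 hw.1 hw.2.1).symm

/-- The graph is partitioned into modules `M v` with representatives `v ∈ S`. -/
structure ModulePartition (G : SimpleGraph (Fin n)) (S : Finset (Fin n))
    (M : Fin n → Finset (Fin n)) : Prop where
  zero_mem : ∀ v : Fin n, v.1 = 0 → v ∈ S
  mem : ∀ v ∈ S, v ∈ M v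
  disjoint : ∀ u ∈ S, ∀ v ∈ S, u ≠ v → Disjoint (M u) (M v)
  cover : ∀ x, ∃ v ∈ S, x ∈ M v
  adj_iff : ∀ u ∈ S, ∀ v ∈ S, u ≠ v → ∀ x ∈ M u, ∀ y ∈ M v, (G.Adj x y ↔ G.Adj u v)

/-- Since `u` and `v` are twins among the representatives, every other module sees both of their
modules in the same way. The larger vertex is dropped, so vertex 0 always survives. -/
theorem ModulePartition.merge {S : Finset (Fin n)} {M : Fin n → Finset (Fin n)}
    (h : ModulePartition G S M) {u v : Fin n} (hu : u ∈ S) (hv : v ∈ S) (huv : u < v)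
    (ht : TwinsIn G S u v) :
    ModulePartition G (S.erase v) (Function.update M u (M u ∪ M v)) where
  zero_mem x hx := by
    refine Finset.mem_erase.2 ⟨?_, h.zero_mem x hx⟩
    rintro rfl
    have : u.1 < x.1 := huv
    omega
  mem x hx := by
    have := h.mem x (Finset.mem_erase.1 hx).2
    by_cases hxu : x = u
    · subst hxu
      simp [this]
    · simpa [hxu] using this
  disjoint x hx y hy hxy := by
    have key : ∀ z ∈ S, z ≠ v → z ≠ u → Disjoint (M u ∪ M v) (M z) := fun z hz hzv hzu =>
      Finset.disjoint_union_left.2 ⟨h.disjoint u hu z hz hzu.symm, h.disjoint v hv z hz hzv.symm⟩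
    rw [Finset.mem_erase] at hx hy
    by_cases hxu : x = u
    · subst hxu
      simpa [hxy.symm] using key y hy.2 hy.1 hxy.symm
    · by_cases hyu : y = u
      · subst hyu
        simpa [hxu] using (key x hx.2 hx.1 hxu).symm
      · simpa [hxu, hyu] using h.disjoint x hx.2 y hy.2 hxy
  cover x := by
    obtain ⟨w, hw, hx⟩ := h.cover x
    have huS : u ∈ S.erase v := Finset.mem_erase.2 ⟨huv.ne, hu⟩
    by_cases hwv : w = v
    · subst hwv
      exact ⟨u, huS, by simp [hx]⟩
    · refine ⟨w, Finset.mem_erase.2 ⟨hwv, hw⟩, ?_⟩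
      by_cases hwu : w = u
      · subst hwu
        simp [hx]
      · simpa [hwu] using hx
  adj_iff x hx y hy hxy p hp q hq := by
    have key : ∀ z ∈ S, z ≠ v → z ≠ u → ∀ p ∈ M u ∪ M v, ∀ q ∈ M z,
        (G.Adj p q ↔ G.Adj u z) := by
      intro z hz hzv hzu p hp q hq
      rcases Finset.mem_union.1 hp with hp | hp
      · exact h.adj_iff u hu z hz hzu.symm p hp q hq
      · rw [h.adj_iff v hv z hz hzv.symm p hp q hq, G.adj_comm v, G.adj_comm u]
        exact (ht z hz hzu hzv).symm
    rw [Finset.mem_erase] at hx hy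
    by_cases hxu : x = u
    · subst hxu
      simp only [Function.update_self, Function.update_of_ne hxy.symm] at hp hq
      exact key y hy.2 hy.1 hxy.symm p hp q hq
    · rw [Function.update_of_ne hxu] at hp
      by_cases hyu : y = u
      · subst hyu
        simp only [Function.update_self] at hq
        rw [G.adj_comm p, G.adj_comm x]
        exact key x hx.2 hx.1 hxu q hq p hp
      · rw [Function.update_of_ne hyu] at hq
        exact h.adj_iff x hx.2 y hy.2 hxy p hp q hq

/-- The memory describes the modules `M v` of the remaining vertices `v ∈ S`. -/
structure Describes (G : SimpleGraph (Fin n)) (A : ℤ → ℤ) (σ : State) (S : Finset (Fin n))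
    (M : Fin n → Finset (Fin n)) : Prop where
  removed : ∀ v : Fin n, σ.arr 2 v.1 = if v ∈ S then 0 else 1
  count : ∀ x < n, ∀ y < n, σ.arr 1 (x * n + y) = ∑ w ∈ S, diff A n w x y
  summary : ∀ v ∈ S, HasSummary G σ v.1 (M v)

/-- The memory describes a partition into `m` modules. -/
def Reduced (G : SimpleGraph (Fin n)) (A : ℤ → ℤ) (m : ℕ) (σ : State) : Prop :=
  ∃ S M, S.card = m ∧ ModulePartition G S M ∧ Describes G A σ S M

theorem Reduced.of_arr_eq {m : ℕ} (h : Reduced G A m σ) (e : τ.arr = σ.arr) :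
    Reduced G A m τ := by
  obtain ⟨S, M, hc, hM, hD⟩ := h
  refine ⟨S, M, hc, hM, by rw [e]; exact hD.removed, by rw [e]; exact hD.count, fun v hv => ?_⟩
  exact (hD.summary v hv).congr ⟨by rw [e], by rw [e], fun i _ => by rw [e]⟩

theorem Describes.mem_of_removed {S : Finset (Fin n)} {M : Fin n → Finset (Fin n)}
    (h : Describes G A σ S M) {v : Fin n} (hv : σ.arr 2 v.1 = 0) : v ∈ S := by
  by_contra hvS
  rw [h.removed, if_neg hvS] at hv
  exact one_ne_zero hv

theorem Describes.exists_twinCode {S : Finset (Fin n)} {M : Fin n → Finset (Fin n)}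
    (h : Describes G (σ.arr 0) σ S M) (hA : IsAdjArray G (σ.arr 0)) (hG : IsCograph G)
    (hS : 2 ≤ S.card) : ∃ a b, TwinCode n σ a b := by
  have key : ∀ u ∈ S, ∀ v ∈ S, u < v → TwinsIn G S u v → TwinCode n σ u v := by
    intro u hu v hv huv ht
    refine ⟨huv, v.2, by rw [h.removed, if_pos hu], by rw [h.removed, if_pos hv], ?_⟩
    rw [h.count _ v.2 _ u.2, hA.sum_diff_eq_iff hu hv huv.ne]
    exact ht
  obtain ⟨u, hu, v, hv, huv, ht⟩ := hG.exists_twins S hS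
  rcases lt_or_gt_of_ne huv with hlt | hlt
  · exact ⟨_, _, key u hu v hv hlt ht⟩
  · exact ⟨_, _, key v hv u hu hlt ht.symm⟩

theorem runs_mergeTwins {m : ℕ} (hW : ((n : ℤ) + 2) ^ 2 ≤ W) (hG : IsCograph G)
    (hn : σ.var 0 = n) (hA : IsAdjArray G (σ.arr 0)) (hR : Reduced G (σ.arr 0) (m + 1) σ)
    (hm : 1 ≤ m) :
    Runs W mergeTwins σ (600 * (n + 1) ^ 2) (Reduced G (σ.arr 0) m) := by
  obtain ⟨S, M, hc, hM, hD⟩ := hR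
  have hSn : S.card ≤ n := by simpa using Finset.card_le_univ S
  refine Runs.mono (T := 100 * (n + 1) ^ 2 + ((12 + 300 * (n + 1) ^ 2) +
    (6 + 100 * (n + 1) ^ 2))) ?_ (by nlinarith) fun _ _ h => h
  refine (runs_findTwins hW hn (hD.exists_twinCode hA hG (by omega))).seq ?_
  rintro τ hτ ⟨a, b, ht, h5, h6⟩
  obtain ⟨u, rfl⟩ : ∃ u : Fin n, u.1 = a := ⟨⟨a, ht.lt.trans ht.lt_card⟩, rfl⟩
  obtain ⟨v, rfl⟩ : ∃ v : Fin n, v.1 = b := ⟨⟨b, ht.lt_card⟩, rfl⟩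
  have hu := hD.mem_of_removed ht.left
  have hv := hD.mem_of_removed ht.right
  have huv : u < v := ht.lt
  have hne : u ≠ v := huv.ne
  have hne' : u.1 ≠ v.1 := ht.lt.ne
  have htw : TwinsIn G S u v := by
    rw [← hA.sum_diff_eq_iff hu hv hne, ← hD.count _ v.2 _ u.2]
    exact ht.count
  have e0 : τ.var 0 = n := by rw [hτ.var 0 (by simp [findTwins]), hn]
  have eA : ∀ a, τ.arr a = σ.arr a := fun a => hτ.arr a (by simp [findTwins])
  have hsum : ∀ x ∈ S, HasSummary G τ x.1 (M x) := fun x hx =>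
    (hD.summary x hx).congr ⟨by rw [eA], by rw [eA], fun i _ => by rw [eA]⟩
  have hdis := hM.disjoint u hu v hv hne
  refine Runs.seq (R := fun υ => HasSummary G υ u.1 (M u ∪ M v) ∧
    ∀ x < n, x ≠ u.1 → x ≠ v.1 → SameSummary n τ υ x) ?_ ?_
  · refine (Runs.ite (T := 300 * (n + 1) ^ 2) (T' := 300 * (n + 1) ^ 2) ?_ ?_).mono
      (by simp [Test.cost, Expr.cost, idx]) fun _ _ h => h
    all_goals
      intro hb
      simp only [Test.Holds, Expr.eval, idx, h5, h6, e0, eA] at hb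
      rw [hA.eq_zero_iff] at hb
    · exact runs_mergeUnion hW e0 h5 h6 u.2 v.2 hne' (hsum u hu) (hsum v hv) hdis
        fun x hx y hy h => hb ((hM.adj_iff u hu v hv hne x hx y hy).1 h)
    · exact runs_mergeJoin hW e0 h5 h6 u.2 v.2 hne' (hsum u hu) (hsum v hv) ⟨u, hM.mem u hu⟩
        ⟨v, hM.mem v hv⟩ hdis fun x hx y hy => (hM.adj_iff u hu v hv hne x hx y hy).2 (not_not.1 hb)
  · rintro υ hυ ⟨hs, hs'⟩
    have f0 : υ.var 0 = n := by
      rw [hυ.var 0 (by simp [mergeUnion, mergeJoin, unionGap, unionTerm, maxGap]), e0]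
    have f6 : υ.var 6 = v.1 := by
      rw [hυ.var 6 (by simp [mergeUnion, mergeJoin, unionGap, unionTerm, maxGap]), h6]
    have fA : ∀ a, a < 3 → υ.arr a = σ.arr a := fun a ha => by
      rw [hυ.arr a (by
        simp [mergeUnion, mergeJoin, unionGap, unionTerm, maxGap]; omega), eA]
    refine Runs.seq (R := fun ω => ω.var 2 = v.1 ∧
      ∀ z, ω.arr 2 z = if z = v.1 then 1 else σ.arr 2 z)
      ((Runs.of_wp ?_).mono (by simp [Program.cost, Expr.cost]) fun _ _ h => h) ?_
    · simp only [Program.wp, Expr.eval, f6, State.setVar_var]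
      have hb : |(v.1 : ℤ)| ≤ W := abs_le_of_sq_le hW (by omega) (by omega)
      exact ⟨hb, by simpa using hb,
        by simpa using abs_le_of_sq_le hW (z := 1) (by omega) (by omega),
        by simp, by simp [fA]⟩
    · rintro ω hω ⟨g2, gr⟩
      have gA : ∀ a, a ≠ 2 → ω.arr a = υ.arr a := fun a ha => hω.arr a (by simpa using ha)
      have gA0 : ω.arr 0 = σ.arr 0 := by rw [gA 0 (by omega), fA 0 (by omega)]
      -- Removing `v` deletes exactly its own term from each count.
      have hcount : ∀ x < n, ∀ y < n, ω.arr 1 (x * n + y) + -1 * diff (ω.arr 0) n v x y =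
          ∑ w ∈ S.erase v, diff (σ.arr 0) n w x y := by
        intro x hx y hy
        rw [gA 1 (by omega), fA 1 (by omega), gA0, hD.count x hx y hy,
          ← Finset.add_sum_erase S _ hv]
        ring
      refine (runs_addDiff (s := -1) (w := v) hW (by rw [hω.var 0 (by simp), f0]) g2 ?_).mono le_rfl
        ?_
      · intro x hx y hy
        rw [hcount x hx y hy]
        exact abs_sum_diff_le hA.zero_or_one hW _ _
          ((Finset.card_le_card (Finset.erase_subset _ _)).trans hSn) _ _
      · intro ρ hρ hρD
        have r2 : ρ.arr 2 = ω.arr 2 := hρ.arr 2 (by simp [addDiff])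
        have hsame : ∀ x, SameSummary n υ ρ x := fun x =>
          ⟨by rw [hρ.arr 3 (by simp [addDiff]), gA 3 (by omega)],
            by rw [hρ.arr 4 (by simp [addDiff]), gA 4 (by omega)],
            fun i _ => by rw [hρ.arr 5 (by simp [addDiff]), gA 5 (by omega)]⟩
        refine ⟨S.erase v, Function.update M u (M u ∪ M v), ?_, hM.merge hu hv huv htw, ?_, ?_, ?_⟩
        · rw [Finset.card_erase_of_mem hv]
          omega
        · intro x
          rw [r2, gr, hD.removed]
          by_cases hxv : x = v
          · simp [hxv]
          · have : x.1 ≠ v.1 := fun h => hxv (Fin.ext h)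
            simp [hxv, this]
        · intro x hx y hy
          rw [hρD x hx y hy, hcount x hx y hy]
        · intro x hx
          by_cases hxu : x = u
          · subst hxu
            simpa using hs.congr (hsame _)
          · rw [Function.update_of_ne hxu]
            have hx' := Finset.mem_erase.1 hx
            exact ((hsum x hx'.2).congr (hs' x x.2 (fun h => hxu (Fin.ext h))
              (fun h => hx'.1 (Fin.ext h)))).congr (hsame _)

theorem runs_readAnswer {k a e : ℕ} {g : ℕ → ℕ} (hW : ((n : ℤ) + 2) ^ 2 ≤ W) (hn : σ.var 0 = n)
    (hk : σ.var 1 = k) (ha : σ.arr 3 0 = a) (he : σ.arr 4 0 = e) (han : a ≤ n)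
    (hg : ∀ i < a, σ.arr 5 i = g i) :
    Runs W readAnswer σ (100 * (n + 1)) fun τ =>
      τ.var 0 = 1 ∧ (e + k ≤ a ∧ ∀ i, k ≤ i → i < a → g i + k ≤ i) ∨
      τ.var 0 = 0 ∧ ¬ (e + k ≤ a ∧ ∀ i, k ≤ i → i < a → g i + k ≤ i) := by
  have hNW : ((n + 1 : ℕ) : ℤ) ≤ W := natCast_le_of_sq_le hW le_rfl
  have hW0 : |(0 : ℤ)| ≤ W := abs_le_of_sq_le hW le_rfl (by omega)
  have hW1 : |(1 : ℤ)| ≤ W := abs_le_of_sq_le hW (by omega) (by omega)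
  let C : ℕ → State → Prop := fun m τ =>
    τ.var 7 = 1 ∧ (e + k ≤ a ∧ ∀ i < m, k ≤ i → i < a → g i + k ≤ i) ∨
    τ.var 7 = 0 ∧ ¬ (e + k ≤ a ∧ ∀ i < m, k ≤ i → i < a → g i + k ≤ i)
  refine Runs.mono (T := 20 + (((n + 1) * 40 + 10) + 5)) ?_ (by omega) fun _ _ h => h
  refine Runs.seq (R := C 0)
    ((Runs.of_wp ?_).mono (by simp [Program.cost, Expr.cost, Test.cost]) fun _ _ h => h) ?_
  · simp only [Program.wp, Expr.eval, Test.Holds, ha, he, hk]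
    refine ⟨fun h => ⟨hW0, Or.inr ⟨by simp, ?_⟩⟩, fun h => ⟨hW1, Or.inl ⟨by simp, ?_⟩⟩⟩
    · omega
    · exact ⟨by omega, by simp⟩
  · intro τ hτ hC
    have eA : ∀ b, τ.arr b = σ.arr b := fun b => hτ.arr b (by simp)
    refine Runs.seq (R := C (n + 1)) ((Runs.for (N := n + 1) (T := 30) C (by simp) hNW ?_ ?_
      ?_).mono ?_ fun _ _ h => h) ?_
    · intro υ hυ i
      simp only [Expr.eval, gapLen, hυ.var 0 (by simp), hτ.var 0 (by simp), hn]
      omega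
    · simpa [C] using hC
    · intro i hi υ hυ hυi hC
      have f1 : υ.var 1 = k := by rw [hυ.var 1 (by simp), hτ.var 1 (by simp), hk]
      have fA : ∀ b, υ.arr b = σ.arr b := fun b => by rw [hυ.arr b (by simp), eA]
      refine (Runs.of_wp ?_).mono (by simp [Program.cost, Expr.cost, Test.cost]) fun _ _ h => h
      simp only [Program.wp, Expr.eval, Test.Holds, hυi, f1, fA, ha]
      refine ⟨fun h => ⟨hW0, Or.inr ⟨by simp, fun hc => ?_⟩⟩, fun h => ?_⟩
      · have := hc.2 i (by omega) (by omega) (by omega)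
        rw [hg i (by omega)] at h
        omega
      · have key : k ≤ i → i < a → g i + k ≤ i := by
          intro h1 h2
          rw [hg i h2] at h
          omega
        have key' : (∀ j < i + 1, k ≤ j → j < a → g j + k ≤ j) ↔
            ∀ j < i, k ≤ j → j < a → g j + k ≤ j := by
          rw [Nat.forall_lt_succ_right]
          exact and_iff_left key
        simp only [C, State.setVar_var, key', show ¬ (7 = 3) by omega, if_false]
        exact hC
    · simp only [Expr.cost, gapLen]
      omega
    · intro υ hυ hC
      refine (Runs.of_wp (Q := fun ω => ω.var 0 = υ.var 7) ?_).mono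
        (by simp [Program.cost, Expr.cost]) fun ω _ hω => ?_
      · simp only [Program.wp, Expr.eval]
        refine ⟨?_, by simp⟩
        rcases hC with hC | hC <;> rwa [hC.1]
      -- Since `a ≤ n`, scanning the sizes up to n covers all i < a.
      · have key : (∀ i < n + 1, k ≤ i → i < a → g i + k ≤ i) ↔
            ∀ i, k ≤ i → i < a → g i + k ≤ i :=
          ⟨fun h i h1 h2 => h i (by omega) h1 h2, fun h i _ => h i⟩
        rw [hω]
        simpa only [C, key] using hC

/-- The memory holds a summary of the whole graph. -/
def Solved (G : SimpleGraph (Fin n)) (σ : State) : Prop :=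
  ∃ a e g, Summary G n Finset.univ a e g ∧ σ.arr 3 0 = (a : ℕ) ∧ σ.arr 4 0 = (e : ℕ) ∧
    ∀ i < a, σ.arr 5 i = (g i : ℕ)

/-- The last representative is vertex 0, so the result is found at a fixed place. -/
theorem Reduced.solved (h : Reduced G A 1 σ) : Solved G σ := by
  obtain ⟨S, M, hc, hM, hD⟩ := h
  obtain ⟨v, rfl⟩ := Finset.card_eq_one.1 hc
  have hv : v.1 = 0 := by
    have := hM.zero_mem ⟨0, v.pos⟩ rfl
    rw [Finset.mem_singleton] at this
    exact congrArg Fin.val this.symm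
  have hu : M v = Finset.univ := by
    ext x
    simpa using hM.cover x
  obtain ⟨a, e, g, hs, ha, he, hg⟩ := hD.summary v (by simp)
  rw [hu] at hs
  have := Summary.alpha_le hs
  refine ⟨a, e, g, hs, by simpa [hv] using ha, by simpa [hv] using he, fun i hi => ?_⟩
  simpa [hv] using hg i (by omega)

theorem reduced_of_setup (h1 : ∀ x < n, ∀ y < n,
      σ.arr 1 (x * n + y) = ∑ w ∈ Finset.range n, diff A n w x y)
    (h2 : σ.arr 2 = 0) (h3 : ∀ v : ℕ, σ.arr 3 v = if v < n then 1 else 0) (h4 : σ.arr 4 = 0)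
    (h5 : ∀ v < n, ∀ i ≤ n, σ.arr 5 (v * (n + 1) + i) = if i = 1 then (n : ℤ) + 1 else 0) :
    Reduced G A n σ := by
  refine ⟨Finset.univ, fun v => {v}, by simp, ⟨by simp, by simp, by simp, by simp, by simp⟩,
    by simp [h2], ?_, ?_⟩
  · intro x hx y hy
    rw [h1 x hx y hy, Finset.sum_range]
  · intro v _
    refine ⟨1, 0, _, summary_singleton v, by simp [h3], by simp [h4], fun i hi => ?_⟩
    rw [h5 v v.2 i hi]
    by_cases h : i = 1 <;> simp [h]

/-- Without vertices the zero-filled memory is already correct; with `a = 0` no gap has to be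
stored. -/
theorem solved_of_isEmpty (hn : n = 0) (h3 : σ.arr 3 0 = 0) (h4 : σ.arr 4 0 = 0) :
    Solved G σ := by
  subst hn
  have key : ∀ I : Finset (Fin 0), I = ∅ := fun I => Subsingleton.elim _ _
  refine ⟨0, 0, fun i => if i = 0 then 1 else 0, ⟨⟨∅, indepIn_empty, rfl⟩, ?_, ?_, ?_, ?_⟩,
    by simpa, by simpa, by simp⟩
  · intro I _
    simp [key I]
  · intro i
    split_ifs <;> simp
  · intro i d hd
    obtain rfl : d = 0 := by omega
    constructor
    · intro hi I _ hIc
      rw [key I, Finset.card_empty] at hIc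
      simp [← hIc] at hi
    · intro h
      split_ifs with hi
      · obtain ⟨J, -, hJ⟩ := h ∅ indepIn_empty hi.symm
        simp [key J] at hJ
      · exact le_rfl
  · intro d
    simp only [zero_le, true_iff]
    intro I J _ _ _ _
    rw [key I, key J]
    exact .refl

end

/-! ### The whole decision procedure and its running time -/

section

variable {W : ℤ} {n : ℕ} {G : SimpleGraph (Fin n)}

theorem isAdjArray_inputState (k : ℤ) : IsAdjArray G ((inputState G k).arr 0) := by
  refine ⟨fun z => ?_, fun i j => ?_⟩
  · simp only [inputState]
    split_ifs <;> simp
  · simp only [inputState]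
    have hiff : (∃ i' j' : Fin n, ((i : ℕ) : ℤ) * n + (j : ℕ) = (i' : ℕ) * n + (j' : ℕ) ∧
        G.Adj i' j') ↔ G.Adj i j := by
      constructor
      · rintro ⟨i', j', h, hadj⟩
        rw [idx_inj (by exact_mod_cast j.2) (by exact_mod_cast j'.2)] at h
        rwa [Fin.ext h.1, Fin.ext h.2]
      · exact fun h => ⟨i, j, rfl, h⟩
    rw [← hiff]
    split_ifs with h
    · exact iff_of_true rfl h.2
    · exact iff_of_false (by simp) fun h' => h ⟨rfl, h'⟩

theorem runs_decideConnected_of_pos {k : ℕ} (hk : 0 < k) (hW : ((n : ℤ) + 2) ^ 2 ≤ W)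
    (hG : IsCograph G) :
    Runs W decideConnected (inputState G k) (1000 * (n + 1) ^ 3) fun τ =>
      τ.var 0 = 1 ∧ (tarGraph G k).Connected ∨ τ.var 0 = 0 ∧ ¬ (tarGraph G k).Connected := by
  have hA := isAdjArray_inputState (G := G) (k : ℤ)
  have v0 : (inputState G k).var 0 = n := rfl
  have v1 : (inputState G k).var 1 = k := rfl
  have hz : ∀ a, a ≠ 0 → (inputState G k).arr a = 0 := by
    intro a ha
    ext z
    simp [inputState, ha]
  generalize inputState G k = σ at *
  refine (Runs.ite (T := 200 * (n + 1) ^ 3 + ((n * (600 * (n + 1) ^ 2 + 10) + 8) +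
    100 * (n + 1))) (T' := 0) (fun _ => ?_) fun hb => ?_).mono ?_ fun _ _ h => h
  rotate_left
  · simp only [Test.Holds, Expr.eval, v1] at hb
    omega
  · simp only [Test.cost, Expr.cost, Nat.max_zero]
    have h2 : 1 ≤ (n + 1) ^ 2 := Nat.one_le_pow _ _ (by omega)
    rw [pow_succ (n + 1) 2]
    generalize (n + 1) ^ 2 = m at *
    nlinarith
  refine (runs_setup hW v0 hA.zero_or_one (hz 1 (by omega)) (hz 3 (by omega))
    (hz 5 (by omega))).seq ?_
  rintro τ hτ ⟨h1, h3, h5⟩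
  have t0 : τ.var 0 = n := by rw [hτ.var 0 (by simp [setup, addDiff]), v0]
  have t1 : τ.var 1 = k := by rw [hτ.var 1 (by simp [setup, addDiff]), v1]
  have t2 : τ.arr 2 = 0 := by rw [hτ.arr 2 (by simp [setup, addDiff]), hz 2 (by omega)]
  have t4 : τ.arr 4 = 0 := by rw [hτ.arr 4 (by simp [setup, addDiff]), hz 4 (by omega)]
  have tA : τ.arr 0 = σ.arr 0 := hτ.arr 0 (by simp [setup, addDiff])
  have hred : Reduced G (σ.arr 0) n τ := reduced_of_setup h1 t2 h3 t4 h5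
  have hw : ∀ x ∈ [0, 1, 9], x ∉ mergeTwins.varWrites := by decide
  have hw' : 0 ∉ mergeTwins.arrWrites := by decide
  refine Runs.seq (R := Solved G) ((Runs.for (N := n - 1) (T := 600 * (n + 1) ^ 2)
    -- For n = 0 the loop bound is -1, so nothing runs, and there is no single module to end with;
    -- the zero cells are carried along instead.
    (fun r υ => if n = 0 then υ.arr 3 0 = 0 ∧ υ.arr 4 0 = 0 else Reduced G (σ.arr 0) (n - r) υ)
    (hw 9 (by simp)) ?_ ?_ ?_ ?_).mono ?_ ?_) ?_
  · exact natCast_le_of_sq_le hW (by omega)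
  · intro υ hυ i
    have := hw 0 (by simp)
    simp only [Expr.eval, hυ.var 0 (by simp [this]), t0]
    omega
  · split_ifs with hn0
    · have := h3 0
      simp only [hn0, lt_irrefl, if_false, Nat.cast_zero] at this
      exact ⟨by simpa using this, by simp [t4]⟩
    · exact hred.of_arr_eq rfl
  · intro r hr υ hυ _ hI
    rw [if_neg (by omega)] at hI
    have := hw 0 (by simp)
    have e0 : υ.var 0 = n := by rw [hυ.var 0 (by simp [this]), t0]
    have eA : υ.arr 0 = σ.arr 0 := by rw [hυ.arr 0 (by simpa using hw'), tA]
    rw [← eA] at hI hA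
    have hm : n - r = (n - (r + 1)) + 1 := by omega
    rw [hm] at hI
    refine (runs_mergeTwins hW hG e0 hA hI (by omega)).mono le_rfl fun ω _ h => ?_
    rw [if_neg (by omega), ← eA]
    exact h.of_arr_eq rfl
  · simp only [Expr.cost]
    rw [show 600 * (n + 1) ^ 2 + (1 + 1 + 1) + 7 = 600 * (n + 1) ^ 2 + 10 by omega]
    have := Nat.mul_le_mul_right (600 * (n + 1) ^ 2 + 10) (Nat.sub_le n 1)
    omega
  · intro υ _ hI
    split_ifs at hI with hn0
    · exact solved_of_isEmpty hn0 hI.1 hI.2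
    · rw [show n - (n - 1) = 1 by omega] at hI
      exact hI.solved
  · rintro υ hυ ⟨a, e, g, hs, ha, he, hg⟩
    have := hw 0 (by simp)
    have := hw 1 (by simp)
    have han := Summary.alpha_le hs
    rw [hs.tarGraph_connected_iff han]
    refine runs_readAnswer hW ?_ ?_ ha he han hg
    · rw [hυ.var 0 (by simp [*]), t0]
    · rw [hυ.var 1 (by simp [*]), t1]

theorem runs_decideConnected (k : ℤ) (hW : ((n : ℤ) + 2) ^ 2 ≤ W) (hG : IsCograph G) :
    Runs W decideConnected (inputState G k) (1000 * (n + 1) ^ 3) fun τ =>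
      τ.var 0 = 1 ∧ (tarGraph G k).Connected ∨ τ.var 0 = 0 ∧ ¬ (tarGraph G k).Connected := by
  rcases le_or_gt k 0 with hk | hk
  -- For k ≤ 0 the program answers 1 at once, so that k can be treated as a natural number
  -- elsewhere.
  · refine (Runs.ite (T := 0) (T' := 2) (fun hb => ?_) fun _ => ?_).mono ?_ fun _ _ h => h
    · simp only [Test.Holds, Expr.eval, inputState] at hb
      simp at hb
      omega
    · refine (Runs.of_wp ?_).mono (by simp [Program.cost, Expr.cost]) fun _ _ h => h
      exact ⟨abs_le_of_sq_le hW (z := 1) (by omega) (by omega),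
        Or.inl ⟨by simp [Expr.eval], tarGraph_connected_of_nonpos hk⟩⟩
    · simp only [Test.cost, Expr.cost]
      have := Nat.one_le_pow 3 (n + 1) (by omega)
      omega
  · lift k to ℕ using hk.le
    exact runs_decideConnected_of_pos (by omega) hW hG

end

end Ram

open Classical in
theorem theorem1 :
    ∃ (P : Ram.Program) (c d : ℕ),
      ∀ (n : ℕ) (G : SimpleGraph (Fin n)) (k : ℤ), IsCograph G →
        ∃ (t : ℕ) (τ : Ram.State),
          Ram.Exec (((n : ℤ) + |k| + 2) ^ d) P (Ram.inputState G k) t τ ∧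
          t ≤ c * (n ^ 3 + 1) ∧
          τ.var 0 = if (tarGraph G k).Connected then 1 else 0 := by
  -- The factor 4000 is 1000 times the 4 lost in passing from (n + 1)³ to n³ + 1; the exponent 2
  -- accommodates matrix addresses.
  refine ⟨Ram.decideConnected, 4000, 2, fun n G k hG => ?_⟩
  have hW : ((n : ℤ) + 2) ^ 2 ≤ ((n : ℤ) + |k| + 2) ^ 2 := by
    have := abs_nonneg k
    gcongr
    omega
  obtain ⟨t, τ, he, ht, hτ⟩ := Ram.runs_decideConnected k hW hG
  refine ⟨t, τ, he, ht.trans ?_, ?_⟩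
  -- The difference of the two sides is 3(n - 1)²(n + 1).
  · have : (n + 1) ^ 3 ≤ 4 * (n ^ 3 + 1) := by
      zify
      nlinarith [mul_nonneg (sq_nonneg ((n : ℤ) - 1)) (show (0 : ℤ) ≤ n + 1 by positivity)]
    omega
  · rcases hτ with ⟨h, hc⟩ | ⟨h, hc⟩
    · rw [h, if_pos hc]
    · rw [h, if_neg hc]
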